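/- All operators are bounded operators on complex Hilbert spaces, $\|\cdot\|$ is the operator norm, and $f(A)$ denotes the continuous functional calculus. For a closed set $\mathfrak F\subset\mathbb R$, a continuous function $f:\mathfrak F\to\mathbb C$ and $\delta\ge 0$ put \[\Omega_{f,\mathfrak F}(\delta)=\sup\{\|f(A)-f(B)\| : A=A^*,\ B=B^*,\ \sigma(A),\sigma(B)\subset\mathfrak F,\ \|A-B\|\le\delta\}\in[0,\infty],\] \[\Omega^\flat_{f,\mathfrak F}(\delta)=\sup\{\|f(A)X-Xf(B)\| : A=A^*,\ B=B^*,\ \sigma(A),\sigma(B)\subset\mathfrak F,\ \|X\|\le 1,\ \|AX-XB\|\le\delta\}\in[0,\infty],\] where the suprema are over operators $A,B$ (and $X$) on an arbitrary Hilbert space. Theorem. Let $\mathfrak F\subset\mathbb R$ be closed and $f:\mathfrak F\to\mathbb C$ continuous. Let $A,B,X$ be bounded operators on a Hilbert space with $A,B$ self-adjoint with spectra in $\mathfrak F$, and $0<\|X\|<\pi$. Then \[\|f(A)X-Xf(B)\|\le\frac{\|X\|}{\sin\|X\|}\,\Omega_{f,\mathfrak F}(\|AX-XB\|).\] Moreover,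 for every $\delta\ge 0$, \[\Omega_{f,\mathfrak F}(\delta)\le\Omega^\flat_{f,\mathfrak F}(\delta)\le\csc(1)\,\Omega_{f,\mathfrak F}(\delta).\] The first inequality is sharp: for every closed $\mathfrak F$ with at least two points there is a continuous real-valued $f$ on $\mathfrak F$ with $0<\Omega_{f,\mathfrak F}(\delta)=\Omega^\flat_{f,\mathfrak F}(\delta)<\infty$ for all $\delta>0$. For $\mathfrak F=\mathbb R$ the second inequality is sharp as well: there are a continuous $f:\mathbb R\to\mathbb R$ and a $\delta>0$ with $0<\Omega_{f,\mathbb R}(\delta)<\infty$ and $\Omega^\flat_{f,\mathbb R}(\delta)=\csc(1)\,\Omega_{f,\mathbb R}(\delta)$; in particular the constant $\csc(1)$ is optimal. Finally, $\csc(1)<1.1884$. -/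

import Mathlib

open scoped ENNReal

universe u

/-- `f(A)` for a self-adjoint bounded operator `A` on a complex Hilbert space and a complex-valued
function `f` of a real variable: the continuous functional calculus of `A`. (The spectrum of `A`
is real, so `f z.re` is `f z` on it.) -/
noncomputable def opFun {H : Type u} [NormedAddCommGroup H] [InnerProductSpace ℂ H]
    [CompleteSpace H] (f : ℝ → ℂ) (A : H →L[ℂ] H) : H →L[ℂ] H :=
  cfc (fun z : ℂ => f z.re) A

/-- The operator modulus of continuity `Ω_{f,F}(δ)`: the supremum in `[0, ∞]` of `‖f(A) - f(B)‖`
over all self-adjoint bounded operators `A`, `B` with spectrum in `F` and `‖A - B‖ ≤ δ`,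
on any complex Hilbert space. -/
noncomputable def opModulus (f : ℝ → ℂ) (F : Set ℝ) (δ : ℝ) : ℝ≥0∞ :=
  sSup {r : ℝ≥0∞ | ∃ (H : Type u) (_ : NormedAddCommGroup H) (_ : InnerProductSpace ℂ H)
    (_ : CompleteSpace H) (A B : H →L[ℂ] H),
    IsSelfAdjoint A ∧ IsSelfAdjoint B ∧ spectrum ℝ A ⊆ F ∧ spectrum ℝ B ⊆ F ∧
    ‖A - B‖ ≤ δ ∧ r = ‖opFun f A - opFun f B‖ₑ}

/-- The commutator modulus of continuity `Ω♭_{f,F}(δ)`: the supremum in `[0, ∞]` of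
`‖f(A) X - X f(B)‖` over all self-adjoint bounded operators `A`, `B` with spectrum in `F` and all
bounded operators `X` with `‖X‖ ≤ 1` and `‖A X - X B‖ ≤ δ`, on any complex Hilbert space. -/
noncomputable def commModulus (f : ℝ → ℂ) (F : Set ℝ) (δ : ℝ) : ℝ≥0∞ :=
  sSup {r : ℝ≥0∞ | ∃ (H : Type u) (_ : NormedAddCommGroup H) (_ : InnerProductSpace ℂ H)
    (_ : CompleteSpace H) (A B X : H →L[ℂ] H),
    IsSelfAdjoint A ∧ IsSelfAdjoint B ∧ spectrum ℝ A ⊆ F ∧ spectrum ℝ B ⊆ F ∧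
    ‖X‖ ≤ 1 ∧ ‖A * X - X * B‖ ≤ δ ∧ r = ‖opFun f A * X - X * opFun f B‖ₑ}

/-! For self-adjoint `X` with `‖X‖ ≤ r < π`, put `U = exp(iX)`. Conjugation by `U` commutes with the
functional calculus, so `‖[U, f(A)]‖ = ‖f(A) - f(U*AU)‖ ≤ Ω(‖[U, A]‖)`, and `‖[U, A]‖ ≤ ‖[X, A]‖` by
differentiating along a path. It remains to recover `[X, f(A)]` from `[U, f(A)]`
(`norm_commutator_le_div_sin_mul`). With `z = ad(iX)`, `exp z` is conjugation by `U` and `z exp(z/2)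
= S (exp z - 1)`, where `S` is the power series of `t exp(t/2)/(exp t - 1) = (t/2)/sinh(t/2)` at
`z`. Here `exp(z/2)` is isometric and `‖z‖ ≤ 2r`. The coefficients of the series become nonnegative
at imaginary arguments, so `‖S‖` is at most its value at `2ir`, which is `r / sin r`. General `A`,
`B`, `X` reduce to this case by `2 × 2` blocks: `diag(A, B)` and the self-adjoint antidiagonal block
operator of `X`, `X*`. Taking `r = 1` gives the constant `csc 1`; taking `X = 1` gives `Ω ≤ Ω♭`.

The first inequality is an equality for `f = id`: `‖AX - XB‖` is at most the length of an interval
with endpoints in `F` containing both spectra, and rotating `diag(a, b)` realizes every norm up to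
`min(δ, b - a)`.

The second is an equality for `f = cos`, `δ = 2`. On one side `Ω(2) ≤ 2 sin 1`, since `s ↦ exp(i
T_s)ξ` is a path of length at most `2` on the unit sphere and its chord is at most `2 sin 1`. On the
other side `Ω♭(2) ≥ 2`: let `A = diag(πk)` and let `X` be a finite section of the Toeplitz matrix of
the triangle wave. Then `[A, X]` is a section for a square wave of height `2`, while `cos A =
diag((-1)^k)` anticommutes with `X`, so `‖[cos A, X]‖ = 2‖X‖`, which tends to `2` as the sections
grow. -/

/-! ### The power series of `(t/2)/sinh(t/2)` in a Banach algebra. -/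

theorem tsum_coeff_smul_pow_mul {𝔸 : Type*} [NormedRing 𝔸] [NormedAlgebra ℂ 𝔸] [CompleteSpace 𝔸]
    (p q : PowerSeries ℂ) (z : 𝔸)
    (hp : Summable fun n => ‖PowerSeries.coeff n p • z ^ n‖)
    (hq : Summable fun n => ‖PowerSeries.coeff n q • z ^ n‖) :
    (∑' n, PowerSeries.coeff n p • z ^ n) * (∑' n, PowerSeries.coeff n q • z ^ n) =
      ∑' n, PowerSeries.coeff n (p * q) • z ^ n := by
  rw [tsum_mul_tsum_eq_tsum_sum_antidiagonal_of_summable_norm hp hq]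
  refine tsum_congr fun n => ?_
  rw [PowerSeries.coeff_mul, Finset.sum_smul]
  refine Finset.sum_congr rfl fun kl hkl => ?_
  rw [smul_mul_smul_comm, ← pow_add, Finset.HasAntidiagonal.mem_antidiagonal.mp hkl]

/-- The Taylor coefficients of `t * exp (t / 2) / (exp t - 1)`. -/
noncomputable def halfBernoulliCoeff (n : ℕ) : ℝ := bernoulliFun n 2⁻¹ / n.factorial

theorem halfBernoulliCoeff_zero : halfBernoulliCoeff 0 = 1 := by
  simp [halfBernoulliCoeff]

theorem halfBernoulliCoeff_odd (k : ℕ) : halfBernoulliCoeff (2 * k + 1) = 0 := by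
  simp [halfBernoulliCoeff, bernoulliFun_eval_half_eq_zero]

/-- Euler's formula for `ζ(2k)` combined with `B_{2k}(1/2) = (2^{1-2k} - 1) B_{2k}`; this exhibits
the alternating signs. -/
theorem halfBernoulliCoeff_even {k : ℕ} (hk : k ≠ 0) :
    (-1) ^ k * halfBernoulliCoeff (2 * k) =
      (1 - 2 / 4 ^ k) * (2 * ∑' n : ℕ, 1 / (n : ℝ) ^ (2 * k)) / (2 * Real.pi) ^ (2 * k) := by
  rw [(hasSum_zeta_nat hk).tsum_eq, halfBernoulliCoeff, bernoulliFun_eval_half]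
  obtain ⟨m, rfl⟩ := Nat.exists_eq_succ_of_ne_zero hk
  have h1 : 2 * (m + 1) - 1 = 2 * m + 1 := by omega
  have h2 : ((-1 : ℝ) ^ m) ^ 2 = 1 := by rw [← pow_mul, mul_comm, pow_mul]; simp
  have h3 : (2 : ℝ) ^ (2 * (m + 1)) = 4 ^ (m + 1) := by rw [pow_mul]; norm_num
  have h4 : (2 : ℝ) ^ (2 * m + 1) = 4 ^ (m + 1) / 2 := by
    rw [pow_succ, pow_mul, pow_succ]; norm_num; ring
  simp only [Nat.succ_eq_add_one]
  rw [h1, mul_pow, h3, h4]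
  have hpi := Real.pi_pos
  field_simp
  ring

theorem halfBernoulliCoeff_even_nonneg (k : ℕ) : 0 ≤ (-1) ^ k * halfBernoulliCoeff (2 * k) := by
  rcases eq_or_ne k 0 with rfl | hk
  · simp [halfBernoulliCoeff_zero]
  · rw [halfBernoulliCoeff_even hk]
    have h4 : (2 : ℝ) / 4 ^ k ≤ 1 := by
      rw [div_le_one (by positivity)]
      calc (2 : ℝ) ≤ 4 ^ 1 := by norm_num
        _ ≤ 4 ^ k := pow_le_pow_right₀ (by norm_num) (Nat.one_le_iff_ne_zero.mpr hk)
    have h5 : 0 ≤ ∑' n : ℕ, 1 / (n : ℝ) ^ (2 * k) := tsum_nonneg fun n => by positivity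
    have := Real.pi_pos
    have : 0 ≤ 1 - (2 : ℝ) / 4 ^ k := by linarith
    positivity

theorem halfBernoulliCoeff_mul_I_pow (n : ℕ) :
    (halfBernoulliCoeff n : ℂ) * Complex.I ^ n = (|halfBernoulliCoeff n| : ℝ) := by
  rcases Nat.even_or_odd' n with ⟨k, rfl | rfl⟩
  · have h := halfBernoulliCoeff_even_nonneg k
    have : |halfBernoulliCoeff (2 * k)| = (-1) ^ k * halfBernoulliCoeff (2 * k) := by
      rw [← abs_of_nonneg h, abs_mul]; simp
    rw [this, pow_mul]
    push_cast
    rw [Complex.I_sq, mul_comm]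
  · simp [halfBernoulliCoeff_odd]

/-- The factor `4` is twice the crude bound `ζ(2k) ≤ ζ(2) ≤ 2`; only the radius of convergence `2π`
matters. -/
theorem abs_halfBernoulliCoeff_le (n : ℕ) :
    |halfBernoulliCoeff n| ≤ 4 / (2 * Real.pi) ^ n := by
  have hpi := Real.pi_pos
  rcases Nat.even_or_odd' n with ⟨k, rfl | rfl⟩
  · rcases eq_or_ne k 0 with rfl | hk
    · simp [halfBernoulliCoeff_zero]
    have h := halfBernoulliCoeff_even_nonneg k
    have h' : |halfBernoulliCoeff (2 * k)| = (-1) ^ k * halfBernoulliCoeff (2 * k) := by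
      rw [← abs_of_nonneg h, abs_mul]; simp
    rw [h', halfBernoulliCoeff_even hk]
    have h2 : ∑' n : ℕ, 1 / (n : ℝ) ^ (2 * k) ≤ 2 := by
      calc ∑' n : ℕ, 1 / (n : ℝ) ^ (2 * k) ≤ ∑' n : ℕ, 1 / (n : ℝ) ^ 2 := by
            refine (hasSum_zeta_nat hk).summable.tsum_le_tsum (fun n => ?_) hasSum_zeta_two.summable
            rcases Nat.eq_zero_or_pos n with rfl | hn
            · simp [hk]
            · have : (1 : ℝ) ≤ n := by exact_mod_cast hn
              exact one_div_le_one_div_of_le (by positivity)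
                (pow_le_pow_right₀ this (by omega))
        _ = Real.pi ^ 2 / 6 := hasSum_zeta_two.tsum_eq
        _ ≤ 2 := by nlinarith [Real.pi_lt_d2]
    have h5 : 0 ≤ ∑' n : ℕ, 1 / (n : ℝ) ^ (2 * k) := tsum_nonneg fun n => by positivity
    have h6 : (0 : ℝ) ≤ 2 / 4 ^ k := by positivity
    gcongr
    nlinarith
  · rw [halfBernoulliCoeff_odd, abs_zero]; positivity

theorem summable_abs_halfBernoulliCoeff_mul_pow {r : ℝ} (h0 : 0 ≤ r) (hr : r < 2 * Real.pi) :
    Summable fun n => |halfBernoulliCoeff n| * r ^ n := by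
  have hpi := Real.pi_pos
  have hg : Summable fun n : ℕ => 4 * (r / (2 * Real.pi)) ^ n :=
    (summable_geometric_of_lt_one (by positivity) ((div_lt_one (by positivity)).mpr hr)).mul_left 4
  refine Summable.of_nonneg_of_le (fun n => by positivity) (fun n => ?_) hg
  calc |halfBernoulliCoeff n| * r ^ n ≤ 4 / (2 * Real.pi) ^ n * r ^ n := by
        gcongr; exact abs_halfBernoulliCoeff_le n
    _ = _ := by rw [div_pow]; ring

theorem norm_halfBernoulliCoeff_smul_pow_le {𝔸 : Type*} [NormedRing 𝔸] [NormOneClass 𝔸]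
    [NormedAlgebra ℂ 𝔸] {r : ℝ} {z : 𝔸} (hz : ‖z‖ ≤ r) (n : ℕ) :
    ‖(halfBernoulliCoeff n : ℂ) • z ^ n‖ ≤ |halfBernoulliCoeff n| * r ^ n := by
  rw [norm_smul, Complex.norm_real, Real.norm_eq_abs]
  gcongr
  exact (norm_pow_le z n).trans (by gcongr)

theorem halfBernoulliCoeff_generating_function :
    (PowerSeries.mk fun n => (halfBernoulliCoeff n : ℂ)) * (PowerSeries.exp ℂ - 1) =
      PowerSeries.X * (PowerSeries.rescale (2⁻¹ : ℂ)) (PowerSeries.exp ℂ) := by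
  rw [← Polynomial.bernoulli_generating_function]
  congr 2
  funext n
  have : (2⁻¹ : ℂ) = algebraMap ℝ ℂ 2⁻¹ := by simp
  rw [this, Polynomial.aeval_algebraMap_apply, map_smul, halfBernoulliCoeff, bernoulliFun,
    Polynomial.eval_map_algebraMap]
  simp [Algebra.smul_def, div_eq_inv_mul]

-- The formal generating identity, evaluated at `z` by Cauchy products; clearing denominators avoids
-- inverting `exp z - 1`.
open NormedSpace in
theorem tsum_halfBernoulliCoeff_mul_exp_sub_one {𝔸 : Type*} [NormedRing 𝔸] [NormOneClass 𝔸]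
    [NormedAlgebra ℂ 𝔸] [CompleteSpace 𝔸] {z : 𝔸} (hz : ‖z‖ < 2 * Real.pi) :
    (∑' n, (halfBernoulliCoeff n : ℂ) • z ^ n) * (exp z - 1) = z * exp ((2⁻¹ : ℂ) • z) := by
  have hexp : ∀ n (w : 𝔸), PowerSeries.coeff n (PowerSeries.exp ℂ) • w ^ n
      = ((n.factorial : ℂ)⁻¹) • w ^ n := by
    intro n w; simp [PowerSeries.coeff_exp]
  have hX : (∑' n, PowerSeries.coeff n (PowerSeries.X : PowerSeries ℂ) • z ^ n) = z := by
    rw [tsum_eq_single 1]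
    · simp
    · intro n hn; simp [PowerSeries.coeff_X, hn]
  have h1 : (∑' n, PowerSeries.coeff n (1 : PowerSeries ℂ) • z ^ n) = 1 := by
    rw [tsum_eq_single 0]
    · simp
    · intro n hn; simp [PowerSeries.coeff_one, hn]
  have s1 : Summable fun n => ‖PowerSeries.coeff n (1 : PowerSeries ℂ) • z ^ n‖ :=
    summable_of_ne_finset_zero (s := {0}) fun n hn => by
      simp [PowerSeries.coeff_one, Finset.notMem_singleton.mp hn]
  have sX : Summable fun n => ‖PowerSeries.coeff n (PowerSeries.X : PowerSeries ℂ) • z ^ n‖ :=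
    summable_of_ne_finset_zero (s := {1}) fun n hn => by
      simp [PowerSeries.coeff_X, Finset.notMem_singleton.mp hn]
  have sE : ∀ w : 𝔸, Summable fun n => ‖PowerSeries.coeff n (PowerSeries.exp ℂ) • w ^ n‖ := by
    intro w; simp_rw [hexp]; exact norm_expSeries_summable' (𝕂 := ℂ) w
  have hE : ∀ w : 𝔸, ∑' n, PowerSeries.coeff n (PowerSeries.exp ℂ) • w ^ n = exp w := by
    intro w; simp_rw [hexp]; rw [exp_eq_tsum ℂ]
  have hR : ∀ n, PowerSeries.coeff n (PowerSeries.rescale (2⁻¹ : ℂ) (PowerSeries.exp ℂ)) • z ^ n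
      = PowerSeries.coeff n (PowerSeries.exp ℂ) • ((2⁻¹ : ℂ) • z) ^ n := by
    intro n; rw [PowerSeries.coeff_rescale, smul_pow, smul_smul, mul_comm]
  have sB : Summable fun n =>
      ‖PowerSeries.coeff n (PowerSeries.mk fun n => (halfBernoulliCoeff n : ℂ)) • z ^ n‖ := by
    refine Summable.of_nonneg_of_le (fun n => norm_nonneg _) (fun n => ?_)
      (summable_abs_halfBernoulliCoeff_mul_pow (norm_nonneg z) hz)
    rw [PowerSeries.coeff_mk]
    exact norm_halfBernoulliCoeff_smul_pow_le le_rfl n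
  have sE1 : Summable fun n => ‖PowerSeries.coeff n (PowerSeries.exp ℂ - 1) • z ^ n‖ := by
    refine Summable.of_nonneg_of_le (fun n => norm_nonneg _) (fun n => ?_) ((sE z).add s1)
    rw [map_sub, sub_smul]
    exact norm_sub_le _ _
  have hE1 : ∑' n, PowerSeries.coeff n (PowerSeries.exp ℂ - 1) • z ^ n = exp z - 1 := by
    simp_rw [map_sub, sub_smul]
    rw [(sE z).of_norm.tsum_sub s1.of_norm, hE, h1]
  have key := tsum_coeff_smul_pow_mul _ _ z sB sE1
  have key' := tsum_coeff_smul_pow_mul PowerSeries.X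
    (PowerSeries.rescale (2⁻¹ : ℂ) (PowerSeries.exp ℂ)) z sX (by simp_rw [hR]; exact sE _)
  rw [halfBernoulliCoeff_generating_function, ← key', hE1, hX] at key
  simp_rw [hR, hE] at key
  simpa using key

/-- At `z = 2ir` each term of the series equals its absolute value, and `exp z - 1 = 2i exp(ir) sin
r`. -/
theorem tsum_abs_halfBernoulliCoeff {r : ℝ} (h0 : 0 < r) (hr : r < Real.pi) :
    ∑' n, |halfBernoulliCoeff n| * (2 * r) ^ n = r / Real.sin r := by
  have hn : ‖(2 * r * Complex.I : ℂ)‖ < 2 * Real.pi := by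
    simp [abs_of_pos h0, hr]
  have h := tsum_halfBernoulliCoeff_mul_exp_sub_one hn
  have hs : ∑' n, (halfBernoulliCoeff n : ℂ) • (2 * r * Complex.I : ℂ) ^ n =
      ((∑' n, |halfBernoulliCoeff n| * (2 * r) ^ n : ℝ) : ℂ) := by
    rw [Complex.ofReal_tsum]
    refine tsum_congr fun n => ?_
    rw [smul_eq_mul, mul_pow, mul_left_comm, halfBernoulliCoeff_mul_I_pow]
    push_cast; ring
  rw [hs, ← Complex.exp_eq_exp_ℂ, smul_eq_mul] at h
  have e1 : (2⁻¹ : ℂ) * (2 * r * Complex.I) = r * Complex.I := by ring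
  have e2 : (2 * r * Complex.I : ℂ) = r * Complex.I + r * Complex.I := by ring
  have e3 : Complex.exp (2 * r * Complex.I) - 1
      = 2 * Complex.I * Complex.exp (r * Complex.I) * (Real.sin r : ℂ) := by
    have h5 : Complex.exp (r * Complex.I) * Complex.exp (-r * Complex.I) = 1 := by
      rw [← Complex.exp_add]; simp
    rw [Complex.ofReal_sin, Complex.sin, e2, Complex.exp_add]
    linear_combination h5 + (Complex.exp (r * Complex.I) ^ 2 -
      Complex.exp (r * Complex.I) * Complex.exp (-r * Complex.I)) * Complex.I_sq
  rw [e1, e3] at h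
  have hsin : Real.sin r ≠ 0 := (Real.sin_pos_of_pos_of_lt_pi h0 hr).ne'
  rw [eq_div_iff hsin]
  have h6 : Complex.exp (r * Complex.I) ≠ 0 := Complex.exp_ne_zero _
  have h7 : (2 * Complex.I * Complex.exp (r * Complex.I)) ≠ 0 := by
    simp [h6]
  apply Complex.ofReal_injective
  apply mul_left_cancel₀ h7
  push_cast at h ⊢
  linear_combination h

/-! ### Commutators with a self-adjoint element and with its exponential. -/

section CStar

open NormedSpace
open Complex (I)

variable {𝔸 : Type*} [CStarAlgebra 𝔸]

theorem exp_mul_exp_neg (x : 𝔸) : exp x * exp (-x) = 1 := by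
  let +nondep : NormedAlgebra ℚ 𝔸 := .restrictScalars ℚ ℂ 𝔸
  rw [← exp_add_of_commute (Commute.neg_right (Commute.refl x)), add_neg_cancel, exp_zero]

theorem exp_neg_mul_exp (x : 𝔸) : exp (-x) * exp x = 1 := by
  simpa using exp_mul_exp_neg (-x)

theorem exp_I_smul_mem_unitary {x : 𝔸} (hx : IsSelfAdjoint x) :
    exp (I • x) ∈ unitary 𝔸 := (selfAdjoint.expUnitary ⟨x, hx⟩).2

theorem exp_real_smul_I_smul_mem_unitary {x : 𝔸} (hx : IsSelfAdjoint x) (s : ℝ) :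
    exp (s • I • x) ∈ unitary 𝔸 := by
  rw [smul_comm]
  exact exp_I_smul_mem_unitary (IsSelfAdjoint.smul (IsSelfAdjoint.all s) hx)

theorem norm_mem_unitary_mul {u : 𝔸} (hu : u ∈ unitary 𝔸) (a : 𝔸) : ‖u * a‖ = ‖a‖ :=
  CStarRing.norm_coe_unitary_mul ⟨u, hu⟩ a

theorem norm_mul_mem_unitary {u : 𝔸} (hu : u ∈ unitary 𝔸) (a : 𝔸) : ‖a * u‖ = ‖a‖ :=
  CStarRing.norm_mul_coe_unitary a ⟨u, hu⟩

/-- The exponentials of self-adjoint elements nearly intertwined by `y` are as nearly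
intertwined by `y`. -/
theorem norm_exp_I_smul_mul_sub_mul_exp_I_smul_le {a b : 𝔸} (ha : IsSelfAdjoint a)
    (hb : IsSelfAdjoint b) (y : 𝔸) :
    ‖exp (I • a) * y - y * exp (I • b)‖ ≤ ‖a * y - y * b‖ := by
  -- This path joins `y * exp (I • b)` to `exp (I • a) * y`; its derivative is `I • (a * y - y * b)`
  -- between two unitaries.
  let g : ℝ → 𝔸 := fun s => exp (s • I • a) * y * exp ((1 - s) • I • b)
  have hg : ∀ s, HasDerivAt g
      (exp (s • I • a) * (I • (a * y - y * b)) * exp ((1 - s) • I • b)) s := by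
    intro s
    have h1 : HasDerivAt (fun s : ℝ => exp (s • I • a)) (exp (s • I • a) * (I • a)) s :=
      hasDerivAt_exp_smul_const (𝕂 := ℝ) (I • a) s
    have h2 : HasDerivAt (fun s : ℝ => exp ((1 - s) • I • b))
        ((-1 : ℝ) • ((I • b) * exp ((1 - s) • I • b))) s :=
      (hasDerivAt_exp_smul_const' (𝕂 := ℝ) (I • b) (1 - s)).scomp s
        ((hasDerivAt_id s).const_sub 1)
    convert! (h1.mul_const y).mul h2 using 1
    simp only [mul_sub, sub_mul, smul_sub, mul_smul_comm, smul_mul_assoc, mul_assoc, neg_smul,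
      one_smul, mul_neg]
    abel
  have := norm_image_sub_le_of_norm_deriv_le_segment_01' (f := g) (C := ‖a * y - y * b‖)
    (fun s _ => (hg s).hasDerivWithinAt) (fun s _ => by
      rw [norm_mul_mem_unitary (exp_real_smul_I_smul_mem_unitary hb _),
        norm_mem_unitary_mul (exp_real_smul_I_smul_mem_unitary ha _), norm_smul]
      simp)
  simpa [g] using this

theorem norm_exp_I_smul_sub_exp_I_smul_le {a b : 𝔸} (ha : IsSelfAdjoint a)
    (hb : IsSelfAdjoint b) : ‖exp (I • a) - exp (I • b)‖ ≤ ‖a - b‖ := by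
  simpa using norm_exp_I_smul_mul_sub_mul_exp_I_smul_le ha hb 1

theorem exp_mulLeft (a : 𝔸) :
    exp (ContinuousLinearMap.mul ℂ 𝔸 a) = ContinuousLinearMap.mul ℂ 𝔸 (exp a) := by
  have hpow : ∀ n : ℕ, ContinuousLinearMap.mul ℂ 𝔸 (a ^ n) = ContinuousLinearMap.mul ℂ 𝔸 a ^ n := by
    intro n
    induction n with
    | zero => ext; simp
    | succ n ih => rw [pow_succ, pow_succ, ← ih]; ext; simp [mul_assoc]
  have h := (exp_series_hasSum_exp' (𝕂 := ℂ) a).mapL (ContinuousLinearMap.mul ℂ 𝔸)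
  have h' := exp_series_hasSum_exp' (𝕂 := ℂ) (ContinuousLinearMap.mul ℂ 𝔸 a)
  refine h'.unique ?_
  convert! h using 2 with n
  rw [map_smul, hpow]

theorem exp_mulRight (a : 𝔸) :
    exp ((ContinuousLinearMap.mul ℂ 𝔸).flip a) = (ContinuousLinearMap.mul ℂ 𝔸).flip (exp a) := by
  have hpow : ∀ n : ℕ, (ContinuousLinearMap.mul ℂ 𝔸).flip (a ^ n) =
      (ContinuousLinearMap.mul ℂ 𝔸).flip a ^ n := by
    intro n
    induction n with
    | zero => ext; simp
    | succ n ih => rw [pow_succ', pow_succ, ← ih]; ext; simp [mul_assoc]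
  have h := (exp_series_hasSum_exp' (𝕂 := ℂ) a).mapL (ContinuousLinearMap.mul ℂ 𝔸).flip
  have h' := exp_series_hasSum_exp' (𝕂 := ℂ) ((ContinuousLinearMap.mul ℂ 𝔸).flip a)
  refine h'.unique ?_
  convert! h using 2 with n
  rw [map_smul, hpow]

/-- The commutator with `a`, as a bounded operator. -/
noncomputable def commutatorCLM (a : 𝔸) : 𝔸 →L[ℂ] 𝔸 :=
  ContinuousLinearMap.mul ℂ 𝔸 a - (ContinuousLinearMap.mul ℂ 𝔸).flip a

theorem commutatorCLM_apply (a t : 𝔸) : commutatorCLM a t = a * t - t * a := by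
  simp [commutatorCLM]

theorem commutatorCLM_smul (c : ℂ) (a : 𝔸) : commutatorCLM (c • a) = c • commutatorCLM a := by
  simp [commutatorCLM, smul_sub]

/-- Left and right multiplications commute, so the exponential of their difference factors. -/
theorem exp_commutatorCLM_apply (a t : 𝔸) :
    exp (commutatorCLM a) t = exp a * t * exp (-a) := by
  have hc : Commute (ContinuousLinearMap.mul ℂ 𝔸 a) ((ContinuousLinearMap.mul ℂ 𝔸).flip (-a)) := by
    ext; simp [mul_assoc]
  let +nondep : NormedAlgebra ℚ (𝔸 →L[ℂ] 𝔸) := .restrictScalars ℚ ℂ _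
  have : commutatorCLM a =
      ContinuousLinearMap.mul ℂ 𝔸 a + (ContinuousLinearMap.mul ℂ 𝔸).flip (-a) := by
    rw [commutatorCLM, map_neg, sub_eq_add_neg]
  rw [this, exp_add_of_commute hc, exp_mulLeft, exp_mulRight]
  simp [mul_assoc]

theorem norm_commutatorCLM_le (a : 𝔸) : ‖commutatorCLM a‖ ≤ 2 * ‖a‖ := by
  refine ContinuousLinearMap.opNorm_le_bound _ (by positivity) fun t => ?_
  rw [commutatorCLM_apply]
  calc ‖a * t - t * a‖ ≤ ‖a * t‖ + ‖t * a‖ := norm_sub_le _ _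
    _ ≤ ‖a‖ * ‖t‖ + ‖t‖ * ‖a‖ := add_le_add (norm_mul_le _ _) (norm_mul_le _ _)
    _ = _ := by ring

/-- The commutator with a self-adjoint element is controlled by the commutator with its
exponential. -/
theorem norm_commutator_le_div_sin_mul {x : 𝔸} (hx : IsSelfAdjoint x) {r : ℝ} (h0 : 0 < r)
    (hr : r < Real.pi) (hxr : ‖x‖ ≤ r) (t : 𝔸) :
    ‖x * t - t * x‖ ≤ r / Real.sin r * ‖exp (I • x) * t - t * exp (I • x)‖ := by
  rcases subsingleton_or_nontrivial 𝔸 with h | h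
  · have hz : ∀ y : 𝔸, ‖y‖ = 0 := fun y => by rw [Subsingleton.elim y 0, norm_zero]
    simp [hz]
  set z : 𝔸 →L[ℂ] 𝔸 := commutatorCLM (I • x) with hz
  have hzr : ‖z‖ ≤ 2 * r := (norm_commutatorCLM_le _).trans (by rw [norm_smul]; simpa using hxr)
  have hgen := tsum_halfBernoulliCoeff_mul_exp_sub_one (z := z) (by linarith)
  set S : 𝔸 →L[ℂ] 𝔸 := ∑' n, (halfBernoulliCoeff n : ℂ) • z ^ n with hS
  have hSn : ‖S‖ ≤ r / Real.sin r := by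
    rw [← tsum_abs_halfBernoulliCoeff h0 hr]
    exact tsum_of_norm_bounded
      (summable_abs_halfBernoulliCoeff_mul_pow (by positivity) (by linarith)).hasSum
      (norm_halfBernoulliCoeff_smul_pow_le hzr)
  -- For real `c`, `exp (c • z)` is conjugation by a unitary, hence isometric.
  have hhalf : ∀ (c : ℝ) (w : 𝔸), ‖exp ((c : ℂ) • z) w‖ = ‖w‖ := by
    intro c w
    rw [hz, ← commutatorCLM_smul, exp_commutatorCLM_apply]
    have e1 : (c : ℂ) • I • x = c • I • x := by simp
    have e2 : -(c : ℂ) • I • x = (-c) • I • x := by rw [← Complex.ofReal_neg]; simp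
    rw [← neg_smul, e1, e2, norm_mul_mem_unitary (exp_real_smul_I_smul_mem_unitary hx _),
      norm_mem_unitary_mul (exp_real_smul_I_smul_mem_unitary hx _)]
  have hI : ‖x * t - t * x‖ = ‖z t‖ := by
    rw [hz, commutatorCLM_smul]
    simp [commutatorCLM_apply, norm_smul]
  -- Multiplying `U t U* - t` on the right by the unitary `U` turns it into `U t - t U`.
  have hE : ‖(exp z - 1) t‖ = ‖exp (I • x) * t - t * exp (I • x)‖ := by
    rw [sub_apply, hz, exp_commutatorCLM_apply,
      ← norm_mul_mem_unitary (exp_I_smul_mem_unitary hx), sub_mul, mul_assoc _ (exp (-(I • x))),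
      exp_neg_mul_exp]
    simp
  have hcomm : Commute z (exp ((2⁻¹ : ℂ) • z)) :=
    Commute.exp_right (show z * ((2⁻¹ : ℂ) • z) = ((2⁻¹ : ℂ) • z) * z by ext; simp)
  have h2 : ((2⁻¹ : ℂ) • z) = (((2⁻¹ : ℝ) : ℂ) • z) := by norm_num
  calc ‖x * t - t * x‖ = ‖exp ((2⁻¹ : ℂ) • z) (z t)‖ := by rw [hI, h2, hhalf]
    _ = ‖(z * exp ((2⁻¹ : ℂ) • z)) t‖ := by rw [hcomm.eq]; rfl
    _ = ‖S ((exp z - 1) t)‖ := by rw [← hgen]; rfl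
    _ ≤ ‖S‖ * ‖(exp z - 1) t‖ := S.le_opNorm _
    _ ≤ _ := by rw [hE]; gcongr

end CStar

/-! ### Functional calculus under star homomorphisms, and the self-adjoint case. -/

section OpFun

theorem IsSelfAdjoint.spectrum_real_subset_iff {𝔸 : Type*} [CStarAlgebra 𝔸] {a : 𝔸}
    (ha : IsSelfAdjoint a) {F : Set ℝ} :
    spectrum ℝ a ⊆ F ↔ ∀ z ∈ spectrum ℂ a, z.re ∈ F := by
  refine ⟨fun h z hz => h ?_, fun h x hx => ?_⟩
  · rw [← spectrum.algebraMap_mem_iff ℂ, Complex.coe_algebraMap, ← ha.mem_spectrum_eq_re hz]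
    exact hz
  · rw [← spectrum.algebraMap_mem_iff ℂ] at hx
    exact h _ hx

theorem continuousOn_comp_re_spectrum {𝔸 : Type*} [CStarAlgebra 𝔸] {a : 𝔸}
    {f : ℝ → ℂ} {F : Set ℝ} (hf : ContinuousOn f F)
    (hF : ∀ z ∈ spectrum ℂ a, z.re ∈ F) : ContinuousOn (fun z : ℂ => f z.re) (spectrum ℂ a) :=
  hf.comp Complex.continuous_re.continuousOn hF

theorem StarAlgHom.map_cfc_re {𝔸 𝔹 : Type*} [CStarAlgebra 𝔸] [CStarAlgebra 𝔹]
    (φ : 𝔸 →⋆ₐ[ℂ] 𝔹) {a : 𝔸} (ha : IsSelfAdjoint a) {f : ℝ → ℂ} {F : Set ℝ}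
    (hf : ContinuousOn f F) (hF : ∀ z ∈ spectrum ℂ a, z.re ∈ F) :
    φ (cfc (fun z : ℂ => f z.re) a) = cfc (fun z : ℂ => f z.re) (φ a) :=
  φ.map_cfc _ a (continuousOn_comp_re_spectrum hf hF) (AddMonoidHomClass.continuous_of_bound φ 1
    fun x => by simpa using NonUnitalStarAlgHom.norm_apply_le φ x) ha.isStarNormal
    (ha.map φ).isStarNormal

theorem isSelfAdjoint_prodMk {𝔸 𝔹 : Type*} [CStarAlgebra 𝔸] [CStarAlgebra 𝔹] {a : 𝔸} {b : 𝔹}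
    (ha : IsSelfAdjoint a) (hb : IsSelfAdjoint b) : IsSelfAdjoint (a, b) := Prod.ext ha hb

theorem spectrum_prodMk_subset {𝔸 𝔹 : Type*} [CStarAlgebra 𝔸] [CStarAlgebra 𝔹] {a : 𝔸}
    {b : 𝔹} {F : Set ℝ} (haF : ∀ z ∈ spectrum ℂ a, z.re ∈ F)
    (hbF : ∀ z ∈ spectrum ℂ b, z.re ∈ F) :
    ∀ z ∈ spectrum ℂ (a, b), z.re ∈ F := by
  rw [Prod.spectrum_eq]
  rintro z (hz | hz)
  exacts [haF z hz, hbF z hz]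

theorem cfc_re_prodMk {𝔸 𝔹 : Type*} [CStarAlgebra 𝔸] [CStarAlgebra 𝔹] {a : 𝔸} {b : 𝔹}
    (ha : IsSelfAdjoint a) (hb : IsSelfAdjoint b) {f : ℝ → ℂ} {F : Set ℝ}
    (hf : ContinuousOn f F) (haF : ∀ z ∈ spectrum ℂ a, z.re ∈ F)
    (hbF : ∀ z ∈ spectrum ℂ b, z.re ∈ F) :
    cfc (fun z : ℂ => f z.re) (a, b) =
      (cfc (fun z : ℂ => f z.re) a, cfc (fun z : ℂ => f z.re) b) :=
  Prod.ext ((StarAlgHom.fst ℂ 𝔸 𝔹).map_cfc_re (isSelfAdjoint_prodMk ha hb) hf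
      (spectrum_prodMk_subset haF hbF))
    ((StarAlgHom.snd ℂ 𝔸 𝔹).map_cfc_re (isSelfAdjoint_prodMk ha hb) hf
      (spectrum_prodMk_subset haF hbF))

theorem StarAlgHom.map_cfc_re_prodMk {𝔸 𝔹 𝔼 : Type*} [CStarAlgebra 𝔸] [CStarAlgebra 𝔹]
    [CStarAlgebra 𝔼] (φ : 𝔸 × 𝔹 →⋆ₐ[ℂ] 𝔼) {a : 𝔸} {b : 𝔹}
    (ha : IsSelfAdjoint a) (hb : IsSelfAdjoint b) {f : ℝ → ℂ} {F : Set ℝ}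
    (hf : ContinuousOn f F) (haF : ∀ z ∈ spectrum ℂ a, z.re ∈ F)
    (hbF : ∀ z ∈ spectrum ℂ b, z.re ∈ F) :
    cfc (fun z : ℂ => f z.re) (φ (a, b)) =
      φ (cfc (fun z : ℂ => f z.re) a, cfc (fun z : ℂ => f z.re) b) := by
  rw [← cfc_re_prodMk ha hb hf haF hbF]
  exact (φ.map_cfc_re (isSelfAdjoint_prodMk ha hb) hf (spectrum_prodMk_subset haF hbF)).symm

theorem StarAlgHom.spectrum_map_prodMk_subset {𝔸 𝔹 𝔼 : Type*} [CStarAlgebra 𝔸]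
    [CStarAlgebra 𝔹] [CStarAlgebra 𝔼] (φ : 𝔸 × 𝔹 →⋆ₐ[ℂ] 𝔼) {a : 𝔸} {b : 𝔹} {F : Set ℝ}
    (haF : ∀ z ∈ spectrum ℂ a, z.re ∈ F)
    (hbF : ∀ z ∈ spectrum ℂ b, z.re ∈ F) :
    ∀ z ∈ spectrum ℂ (φ (a, b)), z.re ∈ F :=
  fun z hz => spectrum_prodMk_subset haF hbF z (AlgHom.spectrum_apply_subset φ.toAlgHom _ hz)

variable {H : Type u} [NormedAddCommGroup H] [InnerProductSpace ℂ H] [CompleteSpace H]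

theorem enorm_opFun_sub_le_opModulus {f : ℝ → ℂ} {F : Set ℝ} {δ : ℝ} {A B : H →L[ℂ] H}
    (hA : IsSelfAdjoint A) (hB : IsSelfAdjoint B)
    (hAF : ∀ z ∈ spectrum ℂ A, z.re ∈ F)
    (hBF : ∀ z ∈ spectrum ℂ B, z.re ∈ F) (h : ‖A - B‖ ≤ δ) :
    ‖opFun f A - opFun f B‖ₑ ≤ opModulus.{u} f F δ :=
  le_sSup ⟨H, _, _, _, A, B, hA, hB, hA.spectrum_real_subset_iff.mpr hAF,
    hB.spectrum_real_subset_iff.mpr hBF, h, rfl⟩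

theorem enorm_opFun_mul_sub_le_commModulus {f : ℝ → ℂ} {F : Set ℝ} {δ : ℝ} {A B X : H →L[ℂ] H}
    (hA : IsSelfAdjoint A) (hB : IsSelfAdjoint B)
    (hAF : ∀ z ∈ spectrum ℂ A, z.re ∈ F)
    (hBF : ∀ z ∈ spectrum ℂ B, z.re ∈ F) (hX : ‖X‖ ≤ 1) (h : ‖A * X - X * B‖ ≤ δ) :
    ‖opFun f A * X - X * opFun f B‖ₑ ≤ commModulus.{u} f F δ :=
  le_sSup ⟨H, _, _, _, A, B, X, hA, hB, hA.spectrum_real_subset_iff.mpr hAF,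
    hB.spectrum_real_subset_iff.mpr hBF, hX, h, rfl⟩

theorem opModulus_le_commModulus (f : ℝ → ℂ) (F : Set ℝ) (δ : ℝ) :
    opModulus.{u} f F δ ≤ commModulus.{u} f F δ := by
  refine sSup_le ?_
  rintro _ ⟨H, _, _, _, A, B, hA, hB, hAF, hBF, h, rfl⟩
  have := enorm_opFun_mul_sub_le_commModulus (f := f) (X := 1) (δ := δ) hA hB
    (hA.spectrum_real_subset_iff.mp hAF) (hB.spectrum_real_subset_iff.mp hBF)
    ContinuousLinearMap.norm_id_le (by simpa using h)
  simpa using this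

theorem enorm_le_ofReal_mul_enorm {E E' : Type*} [SeminormedAddGroup E] [SeminormedAddGroup E']
    {x : E} {y : E'} {c : ℝ} (h : ‖x‖ ≤ c * ‖y‖) (hc : 0 ≤ c) :
    ‖x‖ₑ ≤ ENNReal.ofReal c * ‖y‖ₑ := by
  rw [← ofReal_norm, ← ofReal_norm, ← ENNReal.ofReal_mul hc]
  exact ENNReal.ofReal_le_ofReal h

/-- The homomorphism is `t ↦ u* t u`; it turns commutators with `u` into differences to which the
modulus applies. -/
theorem exists_starAlgHom_norm_sub_apply_eq {𝔸 : Type*} [CStarAlgebra 𝔸] {u : 𝔸}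
    (hu : u ∈ unitary 𝔸) :
    ∃ φ : 𝔸 →⋆ₐ[ℂ] 𝔸, ∀ t, ‖t - φ t‖ = ‖u * t - t * u‖ := by
  let φ : 𝔸 →⋆ₐ[ℂ] 𝔸 := (Unitary.conjStarAlgAut ℂ 𝔸 (star ⟨u, hu⟩)).toStarAlgHom
  refine ⟨φ, fun t => ?_⟩
  have hφ : φ t = star u * t * u := by simp [φ]
  rw [hφ, ← norm_mem_unitary_mul hu (t - _), mul_sub, ← mul_assoc u, ← mul_assoc u,
    Unitary.mul_star_self_of_mem hu, one_mul]

-- Compare `A` with `φ A = U* A U`: their distance is `‖[U, A]‖ ≤ ‖[X, A]‖ ≤ δ`, and `f(φ A) = φ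
-- (f(A))`. The bound on `[U, f(A)]` then passes to `[X, f(A)]`.
open NormedSpace in
theorem enorm_opFun_commutator_le {f : ℝ → ℂ} {F : Set ℝ} (hf : ContinuousOn f F)
    {A X : H →L[ℂ] H} (hA : IsSelfAdjoint A) (hX : IsSelfAdjoint X)
    (hAF : ∀ z ∈ spectrum ℂ A, z.re ∈ F)
    {r δ : ℝ} (h0 : 0 < r) (hr : r < Real.pi) (hXr : ‖X‖ ≤ r) (hδ : ‖A * X - X * A‖ ≤ δ) :
    ‖opFun f A * X - X * opFun f A‖ₑ ≤
      ENNReal.ofReal (r / Real.sin r) * opModulus.{u} f F δ := by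
  let U := exp (Complex.I • X)
  have hU : U ∈ unitary (H →L[ℂ] H) := exp_I_smul_mem_unitary hX
  obtain ⟨φ, hφn⟩ := exists_starAlgHom_norm_sub_apply_eq hU
  have hsin : 0 < Real.sin r := Real.sin_pos_of_pos_of_lt_pi h0 hr
  have h1 := enorm_opFun_sub_le_opModulus (f := f) (F := F) (δ := δ) hA (hA.map φ) hAF
    (fun z hz => hAF z (AlgHom.spectrum_apply_subset φ.toAlgHom A hz)) (by
      rw [hφn]
      refine (norm_exp_I_smul_mul_sub_mul_exp_I_smul_le hX hX A).trans ?_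
      rwa [norm_sub_rev])
  have h2 : opFun f (φ A) = φ (opFun f A) := (φ.map_cfc_re hA hf hAF).symm
  rw [h2] at h1
  refine le_trans ?_ (mul_le_mul_right h1 _)
  refine enorm_le_ofReal_mul_enorm ?_ (by positivity)
  rw [hφn, norm_sub_rev]
  exact norm_commutator_le_div_sin_mul hX h0 hr hXr _

end OpFun

/-! ### Reduction of the general case by `2 × 2` block operators. -/

section Block

variable {H : Type u} [NormedAddCommGroup H] [InnerProductSpace ℂ H]

/-- The operator on `H ⊕ H` with the given `2 × 2` block matrix. -/
noncomputable def blockOp (a b c d : H →L[ℂ] H) : WithLp 2 (H × H) →L[ℂ] WithLp 2 (H × H) :=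
  (WithLp.prodContinuousLinearEquiv 2 ℂ H H).symm.toContinuousLinearMap ∘L
    ((a.coprod b).prod (c.coprod d)) ∘L
      (WithLp.prodContinuousLinearEquiv 2 ℂ H H).toContinuousLinearMap

theorem blockOp_apply (a b c d : H →L[ℂ] H) (x : WithLp 2 (H × H)) :
    blockOp a b c d x = WithLp.toLp 2 (a x.fst + b x.snd, c x.fst + d x.snd) := rfl

theorem blockOp_mul (a b c d a' b' c' d' : H →L[ℂ] H) :
    blockOp a b c d * blockOp a' b' c' d' = blockOp (a * a' + b * c') (a * b' + b * d')
      (c * a' + d * c') (c * b' + d * d') := by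
  refine ContinuousLinearMap.ext fun x => WithLp.ofLp_injective 2 (Prod.ext ?_ ?_)
  · simp [blockOp_apply]; try abel
  · simp [blockOp_apply]; try abel

theorem blockOp_add (a b c d a' b' c' d' : H →L[ℂ] H) :
    blockOp a b c d + blockOp a' b' c' d' = blockOp (a + a') (b + b') (c + c') (d + d') := by
  refine ContinuousLinearMap.ext fun x => WithLp.ofLp_injective 2 (Prod.ext ?_ ?_)
  · simp [blockOp_apply]; try abel
  · simp [blockOp_apply]; try abel

theorem blockOp_sub (a b c d a' b' c' d' : H →L[ℂ] H) :
    blockOp a b c d - blockOp a' b' c' d' = blockOp (a - a') (b - b') (c - c') (d - d') := by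
  refine ContinuousLinearMap.ext fun x => WithLp.ofLp_injective 2 (Prod.ext ?_ ?_)
  · simp [blockOp_apply]; try abel
  · simp [blockOp_apply]; try abel

theorem blockOp_smul (k : ℂ) (a b c d : H →L[ℂ] H) :
    k • blockOp a b c d = blockOp (k • a) (k • b) (k • c) (k • d) := by
  refine ContinuousLinearMap.ext fun x => WithLp.ofLp_injective 2 (Prod.ext ?_ ?_) <;>
    simp [blockOp_apply]

theorem blockOp_one : blockOp (1 : H →L[ℂ] H) 0 0 1 = 1 := by
  refine ContinuousLinearMap.ext fun x => WithLp.ofLp_injective 2 (Prod.ext ?_ ?_) <;>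
    simp [blockOp_apply]

theorem blockOp_zero : blockOp (0 : H →L[ℂ] H) 0 0 0 = 0 := by
  refine ContinuousLinearMap.ext fun x => WithLp.ofLp_injective 2 (Prod.ext ?_ ?_) <;>
    simp [blockOp_apply]

theorem norm_le_norm_blockOp_upper_right (a b c d : H →L[ℂ] H) : ‖b‖ ≤ ‖blockOp a b c d‖ := by
  refine ContinuousLinearMap.opNorm_le_bound _ (norm_nonneg (blockOp a b c d)) fun x => ?_
  have h := (blockOp a b c d).le_opNorm (WithLp.toLp 2 (0, x))
  have h1 : ‖WithLp.toLp 2 ((0 : H), x)‖ = ‖x‖ := by simp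
  rw [h1] at h
  refine le_trans ?_ h
  have h2 := WithLp.norm_fst_le _ (blockOp a b c d (WithLp.toLp 2 (0, x)))
  simpa [blockOp_apply] using h2

theorem norm_blockOp_antidiagonal_le {b c : H →L[ℂ] H} {r : ℝ} (hb : ‖b‖ ≤ r) (hc : ‖c‖ ≤ r) :
    ‖blockOp 0 b c 0‖ ≤ r := by
  have hr : 0 ≤ r := (norm_nonneg b).trans hb
  refine ContinuousLinearMap.opNorm_le_bound _ hr fun x => ?_
  rw [← sq_le_sq₀ (norm_nonneg _) (by positivity), WithLp.prod_norm_sq_eq_of_L2, mul_pow,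
    WithLp.prod_norm_sq_eq_of_L2]
  have h1 : ‖b x.snd‖ ≤ r * ‖x.snd‖ := b.le_of_opNorm_le hb _
  have h2 : ‖c x.fst‖ ≤ r * ‖x.fst‖ := c.le_of_opNorm_le hc _
  have h3 := pow_le_pow_left₀ (norm_nonneg _) h1 2
  have h4 := pow_le_pow_left₀ (norm_nonneg _) h2 2
  simp only [blockOp_apply, zero_apply, zero_add, add_zero]
  change ‖b x.snd‖ ^ 2 + ‖c x.fst‖ ^ 2 ≤ _
  nlinarith

variable [CompleteSpace H]

theorem star_blockOp (a b c d : H →L[ℂ] H) :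
    star (blockOp a b c d) = blockOp (star a) (star c) (star b) (star d) := by
  refine Eq.symm ((ContinuousLinearMap.eq_adjoint_iff _ _).mpr fun x y => ?_)
  simp only [blockOp_apply, WithLp.prod_inner_apply, ContinuousLinearMap.star_eq_adjoint,
    inner_add_left, inner_add_right, ContinuousLinearMap.adjoint_inner_left]
  change inner ℂ x.fst (a y.fst) + inner ℂ x.snd (c y.fst) +
    (inner ℂ x.fst (b y.snd) + inner ℂ x.snd (d y.snd)) = _
  simp only [WithLp.fst, WithLp.snd]
  ring

/-- Direct sums of operators, as a star algebra homomorphism. -/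
noncomputable def blockDiag : ((H →L[ℂ] H) × (H →L[ℂ] H)) →⋆ₐ[ℂ]
    (WithLp 2 (H × H) →L[ℂ] WithLp 2 (H × H)) where
  toFun p := blockOp p.1 0 0 p.2
  map_one' := blockOp_one
  map_mul' p q := by simp [blockOp_mul]
  map_zero' := blockOp_zero
  map_add' p q := by simp [blockOp_add]
  commutes' k := by
    simp [Algebra.algebraMap_eq_smul_one, ← blockOp_one, blockOp_smul]
  map_star' p := by simp [star_blockOp]

theorem isSelfAdjoint_blockOp_diagonal {A B : H →L[ℂ] H} (hA : IsSelfAdjoint A)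
    (hB : IsSelfAdjoint B) : IsSelfAdjoint (blockOp A 0 0 B) :=
  (isSelfAdjoint_prodMk hA hB).map blockDiag

theorem spectrum_blockOp_diagonal_subset {A B : H →L[ℂ] H} {F : Set ℝ}
    (hAF : ∀ z ∈ spectrum ℂ A, z.re ∈ F)
    (hBF : ∀ z ∈ spectrum ℂ B, z.re ∈ F) : ∀ z ∈ spectrum ℂ (blockOp A 0 0 B), z.re ∈ F :=
  (blockDiag (H := H)).spectrum_map_prodMk_subset hAF hBF

theorem opFun_blockOp_diagonal {f : ℝ → ℂ} {F : Set ℝ} (hf : ContinuousOn f F)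
    {A B : H →L[ℂ] H} (hA : IsSelfAdjoint A) (hB : IsSelfAdjoint B)
    (hAF : ∀ z ∈ spectrum ℂ A, z.re ∈ F)
    (hBF : ∀ z ∈ spectrum ℂ B, z.re ∈ F) :
    opFun f (blockOp A 0 0 B) = blockOp (opFun f A) 0 0 (opFun f B) :=
  (blockDiag (H := H)).map_cfc_re_prodMk hA hB hf hAF hBF

theorem enorm_opFun_mul_sub_le {f : ℝ → ℂ} {F : Set ℝ} (hf : ContinuousOn f F)
    {A B X : H →L[ℂ] H} (hA : IsSelfAdjoint A) (hB : IsSelfAdjoint B)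
    (hAF : ∀ z ∈ spectrum ℂ A, z.re ∈ F)
    (hBF : ∀ z ∈ spectrum ℂ B, z.re ∈ F) {r δ : ℝ} (h0 : 0 < r) (hr : r < Real.pi) (hXr : ‖X‖ ≤ r)
    (hδ : ‖A * X - X * B‖ ≤ δ) :
    ‖opFun f A * X - X * opFun f B‖ₑ ≤
      ENNReal.ofReal (r / Real.sin r) * opModulus.{u} f F δ := by
  have hX : IsSelfAdjoint (blockOp 0 X (star X) 0) := by
    rw [IsSelfAdjoint, star_blockOp]; simp
  -- The block commutator has off-diagonal corners `A X - X B` and minus its adjoint, so its norm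
  -- does not exceed `δ`.
  have hstar : B * star X - star X * A = -star (A * X - X * B) := by
    rw [star_sub, star_mul, star_mul, hA.star_eq, hB.star_eq]; abel
  have h := enorm_opFun_commutator_le hf (isSelfAdjoint_blockOp_diagonal hA hB) hX
    (spectrum_blockOp_diagonal_subset hAF hBF) h0 hr
    (norm_blockOp_antidiagonal_le hXr (by rwa [norm_star])) (δ := δ) (by
      rw [blockOp_mul, blockOp_mul, blockOp_sub]
      simp only [mul_zero, zero_mul, add_zero, zero_add, sub_self]
      refine norm_blockOp_antidiagonal_le hδ ?_
      rwa [hstar, norm_neg, norm_star])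
  refine le_trans ?_ h
  rw [opFun_blockOp_diagonal hf hA hB hAF hBF, blockOp_mul, blockOp_mul, blockOp_sub]
  simp only [mul_zero, zero_mul, add_zero, zero_add, sub_self]
  rw [← ofReal_norm, ← ofReal_norm]
  exact ENNReal.ofReal_le_ofReal (norm_le_norm_blockOp_upper_right _ _ _ _)

theorem commModulus_le {f : ℝ → ℂ} {F : Set ℝ} (hf : ContinuousOn f F) (δ : ℝ) :
    commModulus.{u} f F δ ≤ ENNReal.ofReal (1 / Real.sin 1) * opModulus.{u} f F δ := by
  refine sSup_le ?_
  rintro _ ⟨H, _, _, _, A, B, X, hA, hB, hAF, hBF, hX, h, rfl⟩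
  -- The choice `r = 1` bounds every `X` in the unit ball at once and produces `csc 1`.
  exact enorm_opFun_mul_sub_le hf hA hB (hA.spectrum_real_subset_iff.mp hAF)
    (hB.spectrum_real_subset_iff.mp hBF) one_pos
    (by linarith [Real.pi_gt_three]) hX h

end Block

/-! ### Sharpness of the first inequality: the identity function. -/

section Identity

variable {H : Type u} [NormedAddCommGroup H] [InnerProductSpace ℂ H]

theorem spectrum_real_smul_one {a : ℝ} {F : Set ℝ} (ha : a ∈ F) :
    ∀ z ∈ spectrum ℂ ((a : ℂ) • (1 : H →L[ℂ] H)), z.re ∈ F := by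
  intro z hz
  rcases subsingleton_or_nontrivial (H →L[ℂ] H) with h | h
  · simp [spectrum.of_subsingleton] at hz
  · rw [← Algebra.algebraMap_eq_smul_one, spectrum.scalar_eq] at hz
    rw [hz]
    exact ha

variable [CompleteSpace H]

theorem opFun_ofReal {A : H →L[ℂ] H} (hA : IsSelfAdjoint A) :
    opFun (fun x => ((id x : ℝ) : ℂ)) A = A := by
  have h : opFun (fun x => ((id x : ℝ) : ℂ)) A = cfc id A :=
    cfc_congr fun z hz => (hA.mem_spectrum_eq_re hz).symm
  rw [h]
  exact cfc_id ℂ A hA.isStarNormal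

theorem norm_sub_smul_one_le {𝔸 : Type*} [CStarAlgebra 𝔸] {a : 𝔸} (ha : IsSelfAdjoint a)
    {c r : ℝ} (hr : 0 ≤ r) (h : ∀ z ∈ spectrum ℂ a, |z.re - c| ≤ r) :
    ‖a - (c : ℂ) • (1 : 𝔸)‖ ≤ r := by
  have hn := ha.isStarNormal
  have : a - (c : ℂ) • (1 : 𝔸) = cfc (fun z : ℂ => z - c) a := by
    rw [cfc_sub _ _ a, cfc_id' ℂ a, cfc_const (c : ℂ) a, Algebra.algebraMap_eq_smul_one]
  rw [this]
  refine norm_cfc_le hr fun z hz => ?_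
  rw [ha.mem_spectrum_eq_re hz, ← Complex.ofReal_sub, Complex.norm_real]
  exact h z hz

/-- Subtracting the same scalar from `A` and `B` leaves `A X - X B` unchanged; the midpoint of the
joint spectrum makes both norms at most `(b - a) / 2`. -/
theorem exists_norm_mul_sub_mul_le_sub [Nontrivial H] {F : Set ℝ} {A B X : H →L[ℂ] H}
    (hA : IsSelfAdjoint A) (hB : IsSelfAdjoint B) (hAF : ∀ z ∈ spectrum ℂ A, z.re ∈ F)
    (hBF : ∀ z ∈ spectrum ℂ B, z.re ∈ F) (hX : ‖X‖ ≤ 1) :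
    ∃ a ∈ F, ∃ b ∈ F, ‖A * X - X * B‖ ≤ b - a := by
  set K : Set ℝ := Complex.re '' (spectrum ℂ A ∪ spectrum ℂ B) with hK
  have hKc : IsCompact K :=
    ((spectrum.isCompact A).union (spectrum.isCompact B)).image Complex.continuous_re
  have hKn : K.Nonempty := ((spectrum.nonempty A).mono Set.subset_union_left).image _
  have hKF : K ⊆ F := by
    rintro _ ⟨z, hz | hz, rfl⟩
    exacts [hAF z hz, hBF z hz]
  obtain ⟨a, ha, hamin⟩ := hKc.exists_isLeast hKn
  obtain ⟨b, hb, hbmax⟩ := hKc.exists_isGreatest hKn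
  refine ⟨a, hKF ha, b, hKF hb, ?_⟩
  have hab : a ≤ b := hamin hb
  have hmid : ∀ z ∈ spectrum ℂ A ∪ spectrum ℂ B, |z.re - (a + b) / 2| ≤ (b - a) / 2 := by
    intro z hz
    have h1 := hamin ⟨z, hz, rfl⟩
    have h2 := hbmax ⟨z, hz, rfl⟩
    rw [abs_le]
    constructor <;> linarith
  have h1 := norm_sub_smul_one_le hA (by linarith) fun z hz => hmid z (Or.inl hz)
  have h2 := norm_sub_smul_one_le hB (by linarith) fun z hz => hmid z (Or.inr hz)
  set C : H →L[ℂ] H := (((a + b) / 2 : ℝ) : ℂ) • 1 with hC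
  have h3 : A * X - X * B = (A - C) * X - X * (B - C) := by
    have : C * X = X * C := by simp [hC]
    rw [sub_mul, mul_sub, this]; abel
  rw [h3]
  calc ‖(A - C) * X - X * (B - C)‖ ≤ ‖A - C‖ * ‖X‖ + ‖X‖ * ‖B - C‖ :=
        (norm_sub_le _ _).trans (add_le_add (norm_mul_le _ _) (norm_mul_le _ _))
    _ ≤ (b - a) / 2 * 1 + 1 * ((b - a) / 2) := by gcongr
    _ = b - a := by ring

theorem isSelfAdjoint_real_smul_one (a : ℝ) : IsSelfAdjoint ((a : ℂ) • (1 : H →L[ℂ] H)) :=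
  IsSelfAdjoint.smul (Complex.conj_ofReal a) (IsSelfAdjoint.one _)

theorem ofReal_le_opModulus_id_of_nontrivial (K : Type u) [NormedAddCommGroup K]
    [InnerProductSpace ℂ K] [CompleteSpace K] [Nontrivial K] {F : Set ℝ} {a b ρ δ : ℝ}
    (ha : a ∈ F) (hb : b ∈ F) (hρ : 0 ≤ ρ) (hab : ρ ≤ b - a) (hδ : ρ ≤ δ) :
    ENNReal.ofReal ρ ≤ opModulus.{u} (fun x => ((id x : ℝ) : ℂ)) F δ := by
  rcases hρ.eq_or_lt with rfl | hρ
  · simp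
  -- The sine of a rotation angle: the commutator of `diag(a, b)` with the rotation `R` has
  -- off-diagonal entries of modulus `(b - a) s = ρ`.
  set s : ℝ := ρ / (b - a) with hs
  have hba : 0 < b - a := hρ.trans_le hab
  have hs0 : 0 ≤ s := by positivity
  have hs1 : s ≤ 1 := (div_le_one hba).mpr hab
  have hsρ : (b - a) * s = ρ := by rw [hs]; field_simp
  set c : ℝ := Real.sqrt (1 - s ^ 2) with hc
  have hcs : c * c + s * s = 1 := by
    have := Real.mul_self_sqrt (show 0 ≤ 1 - s ^ 2 by nlinarith)
    rw [← hc] at this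
    linarith
  have hcs' : (c : ℂ) * c + s * s = 1 := by exact_mod_cast hcs
  let k : ℂ → (K →L[ℂ] K) := fun z => z • 1
  have hk : ∀ z w, k z * k w = k (z * w) := fun z w => by simp [k, smul_smul, mul_comm]
  have hk' : ∀ z w, k z + k w = k (z + w) := fun z w => by simp [k, add_smul]
  have hk'' : ∀ z w, k z - k w = k (z - w) := fun z w => by simp [k, sub_smul]
  have hkstar : ∀ x : ℝ, star (k x) = k x := fun x => isSelfAdjoint_real_smul_one x
  set A := blockOp (k a) 0 0 (k b) with hAdef
  have hA : IsSelfAdjoint A :=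
    isSelfAdjoint_blockOp_diagonal (isSelfAdjoint_real_smul_one a) (isSelfAdjoint_real_smul_one b)
  have hAF : ∀ z ∈ spectrum ℂ A, z.re ∈ F :=
    spectrum_blockOp_diagonal_subset (spectrum_real_smul_one ha) (spectrum_real_smul_one hb)
  set R := blockOp (k c) (k (-s : ℝ)) (k s) (k c) with hR
  have hone : blockOp (k 1) (k 0) (k 0) (k 1) = 1 := by
    rw [← blockOp_one]; simp [k]
  have hRu : R ∈ unitary _ := by
    rw [Unitary.mem_iff, hR, star_blockOp, blockOp_mul, blockOp_mul, ← hone]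
    simp only [hkstar, hk, hk']
    constructor
    · congr 2 <;> push_cast <;> first | ring1 | linear_combination hcs'
    · congr 2 <;> push_cast <;> first | ring1 | linear_combination hcs'
  obtain ⟨φ, hφ⟩ := exists_starAlgHom_norm_sub_apply_eq hRu
  have hcomm : ‖R * A - A * R‖ = ρ := by
    have : R * A - A * R = blockOp 0 (k (-ρ : ℝ)) (k (-ρ : ℝ)) 0 := by
      rw [hR, hAdef, blockOp_mul, blockOp_mul, blockOp_sub]
      simp only [mul_zero, zero_mul, add_zero, zero_add, hk, hk'', ← hsρ]
      have h0 : (0 : K →L[ℂ] K) = k 0 := by simp [k]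
      rw [h0]
      congr 2 <;> push_cast <;> ring
    have hkn : ‖k (-ρ : ℝ)‖ = ρ := by simp [k, norm_smul, abs_of_pos hρ]
    rw [this]
    refine le_antisymm (norm_blockOp_antidiagonal_le hkn.le hkn.le) ?_
    calc ρ = ‖k (-ρ : ℝ)‖ := hkn.symm
      _ ≤ _ := norm_le_norm_blockOp_upper_right _ _ _ _
  have key := enorm_opFun_sub_le_opModulus (f := fun x => ((id x : ℝ) : ℂ)) (F := F) (δ := δ)
    hA (hA.map φ) hAF (fun z hz => hAF z (AlgHom.spectrum_apply_subset φ.toAlgHom A hz))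
    (by rw [hφ, hcomm]; exact hδ)
  rwa [opFun_ofReal hA, opFun_ofReal (hA.map φ), ← ofReal_norm, hφ, hcomm] at key

theorem ofReal_le_opModulus_id {F : Set ℝ} {a b ρ δ : ℝ} (ha : a ∈ F) (hb : b ∈ F)
    (hρ : 0 ≤ ρ) (hab : ρ ≤ b - a) (hδ : ρ ≤ δ) :
    ENNReal.ofReal ρ ≤ opModulus.{u} (fun x => ((id x : ℝ) : ℂ)) F δ :=
  -- A one-dimensional Hilbert space in universe `u`.
  ofReal_le_opModulus_id_of_nontrivial (EuclideanSpace ℂ PUnit.{u + 1}) ha hb hρ hab hδ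

theorem commModulus_id_le_opModulus_id (F : Set ℝ) (δ : ℝ) :
    commModulus.{u} (fun x => ((id x : ℝ) : ℂ)) F δ ≤
      opModulus.{u} (fun x => ((id x : ℝ) : ℂ)) F δ := by
  refine sSup_le ?_
  rintro _ ⟨H, _, _, _, A, B, X, hA, hB, hAF, hBF, hX, h, rfl⟩
  rw [opFun_ofReal hA, opFun_ofReal hB]
  rcases subsingleton_or_nontrivial H with hH | hH
  · rw [Subsingleton.elim (A * X - X * B) 0]
    simp
  · obtain ⟨a, ha, b, hb, hab⟩ := exists_norm_mul_sub_mul_le_sub hA hB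
      (hA.spectrum_real_subset_iff.mp hAF) (hB.spectrum_real_subset_iff.mp hBF) hX
    rw [← ofReal_norm]
    exact ofReal_le_opModulus_id ha hb (norm_nonneg _) hab h

theorem opModulus_id_lt_top (F : Set ℝ) (δ : ℝ) :
    opModulus.{u} (fun x => ((id x : ℝ) : ℂ)) F δ < ∞ := by
  refine lt_of_le_of_lt (sSup_le ?_) (ENNReal.ofReal_lt_top (r := δ))
  rintro _ ⟨H, _, _, _, A, B, hA, hB, -, -, h, rfl⟩
  rw [opFun_ofReal hA, opFun_ofReal hB, ← ofReal_norm]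
  exact ENNReal.ofReal_le_ofReal h

theorem opModulus_id_pos {F : Set ℝ} (hF : F.Nontrivial) {δ : ℝ} (hδ : 0 < δ) :
    0 < opModulus.{u} (fun x => ((id x : ℝ) : ℂ)) F δ := by
  obtain ⟨a, ha, b, hb, hab⟩ := hF.exists_lt
  have h : 0 < min δ (b - a) := lt_min hδ (sub_pos.mpr hab)
  exact (ENNReal.ofReal_pos.mpr h).trans_le
    (ofReal_le_opModulus_id ha hb h.le (min_le_right _ _) (min_le_left _ _))

end Identity

/-! ### Chords of Lipschitz paths on the unit sphere. -/

section Angle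

open InnerProductGeometry

variable {E : Type*} [NormedAddCommGroup E] [InnerProductSpace ℝ E]

theorem norm_sub_eq_two_mul_sin_angle_div_two {x y : E} (hx : ‖x‖ = 1) (hy : ‖y‖ = 1) :
    ‖x - y‖ = 2 * Real.sin (angle x y / 2) := by
  have h0 : 0 ≤ Real.sin (angle x y / 2) :=
    Real.sin_nonneg_of_nonneg_of_le_pi (by linarith [angle_nonneg x y])
      (by linarith [angle_le_pi x y, angle_nonneg x y])
  have h1 : inner ℝ x y = Real.cos (angle x y) := by
    rw [cos_angle, hx, hy]; simp
  have h2 : ‖x - y‖ ^ 2 = (2 * Real.sin (angle x y / 2)) ^ 2 := by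
    rw [norm_sub_sq_real, hx, hy, h1]
    have h3 := Real.cos_sq (angle x y / 2)
    rw [mul_div_cancel₀ _ (two_ne_zero' ℝ)] at h3
    have h4 := Real.sin_sq_add_cos_sq (angle x y / 2)
    linear_combination (-4 : ℝ) * h4 + 4 * h3
  exact (pow_left_inj₀ (norm_nonneg _) (by positivity) two_ne_zero).mp h2

theorem angle_le_two_mul_arcsin {x y : E} {c : ℝ} (hx : ‖x‖ = 1) (hy : ‖y‖ = 1)
    (h : ‖x - y‖ ≤ c) : angle x y ≤ 2 * Real.arcsin (c / 2) := by
  rw [norm_sub_eq_two_mul_sin_angle_div_two hx hy] at h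
  have h1 : angle x y / 2 = Real.arcsin (Real.sin (angle x y / 2)) :=
    (Real.arcsin_sin (by linarith [angle_nonneg x y, Real.pi_pos])
      (by linarith [angle_le_pi x y])).symm
  have h2 : Real.arcsin (Real.sin (angle x y / 2)) ≤ Real.arcsin (c / 2) :=
    Real.monotone_arcsin (by linarith)
  linarith

theorem angle_le_nat_mul {x : ℕ → E} {θ : ℝ} (h0 : x 0 ≠ 0)
    (h : ∀ k, angle (x k) (x (k + 1)) ≤ θ) (n : ℕ) : angle (x 0) (x n) ≤ n * θ := by
  induction n with
  | zero => simp [angle_self h0]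
  | succ n ih =>
    calc angle (x 0) (x (n + 1)) ≤ angle (x 0) (x n) + angle (x n) (x (n + 1)) :=
          angle_le_angle_add_angle _ _ _
      _ ≤ n * θ + θ := add_le_add ih (h n)
      _ = _ := by push_cast; ring

theorem tendsto_nat_mul_two_mul_arcsin (δ : ℝ) :
    Filter.Tendsto (fun n : ℕ => ((n + 1 : ℕ) : ℝ) * (2 * Real.arcsin (δ / (n + 1 : ℕ) / 2)))
      Filter.atTop (nhds δ) := by
  have h1 : HasDerivAt (fun t : ℝ => 2 * Real.arcsin (δ * t / 2)) δ 0 := by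
    have h2 : HasDerivAt (fun t : ℝ => δ * t / 2) (δ / 2) 0 := by
      simpa using ((hasDerivAt_id (0 : ℝ)).const_mul δ).div_const 2
    have h3 : HasDerivAt Real.arcsin 1 (δ * 0 / 2) := by
      have := Real.hasDerivAt_arcsin (x := 0) (by norm_num) (by norm_num)
      simpa using this
    simpa [mul_div_cancel₀] using! (h3.comp (0 : ℝ) h2).const_mul 2
  -- The limit is the derivative at `0` of `t ↦ 2 arcsin(δ t / 2)`, taken along `t = 1 / (n + 1)`.
  have h4 := h1.tendsto_slope_zero_right
  have h5 := h4.comp (tendsto_nhdsWithin_iff.mpr ⟨tendsto_one_div_add_atTop_nhds_zero_nat (𝕜 := ℝ),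
    Filter.Eventually.of_forall fun n => Set.mem_Ioi.mpr (by positivity)⟩)
  refine h5.congr fun n => ?_
  simp [div_eq_mul_inv]

/-- Cut the path into `n + 1` equal pieces: each turns by at most `2 arcsin(δ / (2(n + 1)))`, angles
satisfy the triangle inequality, and the total tends to `δ`. -/
theorem norm_sub_le_two_mul_sin_of_lipschitz {γ : ℝ → E} {δ : ℝ} (hδ : δ ≤ Real.pi)
    (h0 : 0 ≤ δ) (hγ : ∀ s, ‖γ s‖ = 1) (hL : ∀ s t, ‖γ s - γ t‖ ≤ δ * |s - t|) :
    ‖γ 0 - γ 1‖ ≤ 2 * Real.sin (δ / 2) := by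
  have hang : angle (γ 0) (γ 1) ≤ δ := by
    refine ge_of_tendsto' (tendsto_nat_mul_two_mul_arcsin δ) fun n => ?_
    have hn : ((n + 1 : ℕ) : ℝ) ≠ 0 := by positivity
    have := angle_le_nat_mul (x := fun k => γ (k / (n + 1 : ℕ)))
      (θ := 2 * Real.arcsin (δ / (n + 1 : ℕ) / 2))
      (by rw [← norm_ne_zero_iff, hγ]; exact one_ne_zero)
      (fun k => angle_le_two_mul_arcsin (hγ _) (hγ _) ((hL _ _).trans (le_of_eq ?_))) (n + 1)
    · rwa [div_self hn, Nat.cast_zero, zero_div] at this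
    · rw [← sub_div, Nat.cast_succ k, sub_add_cancel_left, abs_div, abs_neg, abs_one, Nat.abs_cast]
      ring
  rw [norm_sub_eq_two_mul_sin_angle_div_two (hγ _) (hγ _)]
  have := Real.sin_le_sin_of_le_of_le_pi_div_two
    (show -(Real.pi / 2) ≤ angle (γ 0) (γ 1) / 2 by
      linarith [angle_nonneg (γ 0) (γ 1), Real.pi_pos])
    (show δ / 2 ≤ Real.pi / 2 by linarith) (by linarith)
  linarith

end Angle

/-! ### Upper bound for the operator modulus of the cosine. -/

section CosUpper

open NormedSpace
open Complex (I)

variable {H : Type u} [NormedAddCommGroup H] [InnerProductSpace ℂ H] [CompleteSpace H]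

theorem norm_exp_I_smul_sub_exp_I_smul_le_two_mul_sin {A B : H →L[ℂ] H} (hA : IsSelfAdjoint A)
    (hB : IsSelfAdjoint B) {δ : ℝ} (hδ : δ ≤ Real.pi) (h : ‖A - B‖ ≤ δ) :
    ‖exp (I • A) - exp (I • B)‖ ≤ 2 * Real.sin (δ / 2) := by
  have h0 : 0 ≤ δ := (norm_nonneg _).trans h
  have hsin : 0 ≤ Real.sin (δ / 2) :=
    Real.sin_nonneg_of_nonneg_of_le_pi (by linarith) (by linarith)
  -- Along this segment the vectors `exp(i T_s) ξ` stay on the unit sphere and move with speed at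
  -- most `‖A - B‖ ≤ δ`.
  let T : ℝ → (H →L[ℂ] H) := fun s => A + s • (B - A)
  have hT : ∀ s, IsSelfAdjoint (T s) := fun s =>
    hA.add (IsSelfAdjoint.smul (IsSelfAdjoint.all s) (hB.sub hA))
  refine ContinuousLinearMap.opNorm_le_of_unit_norm (by positivity) fun ξ hξ => ?_
  let _ : InnerProductSpace ℝ H := InnerProductSpace.rclikeToReal ℂ H
  have key := norm_sub_le_two_mul_sin_of_lipschitz (γ := fun s => exp (I • T s) ξ) hδ h0
    (fun s => by
      have := Unitary.norm_map (⟨_, exp_I_smul_mem_unitary (hT s)⟩ : unitary (H →L[ℂ] H)) ξ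
      rw [← hξ]
      exact this)
    (fun s t => by
      rw [← sub_apply]
      refine (ContinuousLinearMap.le_opNorm _ _).trans ?_
      rw [hξ, mul_one]
      refine (norm_exp_I_smul_sub_exp_I_smul_le (hT s) (hT t)).trans ?_
      have : T s - T t = (s - t) • (B - A) := by simp only [T, sub_smul]; abel
      rw [this, norm_smul, norm_sub_rev B A, mul_comm, Real.norm_eq_abs]
      gcongr)
  simpa [T] using key

theorem cfc_exp_I_mul {A : H →L[ℂ] H} (hA : IsSelfAdjoint A) :
    cfc (fun z : ℂ => Complex.exp (I * z)) A = exp (I • A) := by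
  have hn := hA.isStarNormal
  have h1 : cfc (fun z : ℂ => I * z) A = I • A := cfc_const_mul_id I A
  have hI : IsStarNormal (I • A) := by rw [← h1]; exact cfc_predicate _ _
  rw [← CFC.exp_eq_normedSpace_exp (𝕜 := ℂ) (a := I • A), ← h1,
    ← cfc_comp' (NormedSpace.exp : ℂ → ℂ) (fun z : ℂ => I * z) A, Complex.exp_eq_exp_ℂ]

theorem opFun_cos {A : H →L[ℂ] H} (hA : IsSelfAdjoint A) :
    opFun (fun x => (Real.cos x : ℂ)) A = (2⁻¹ : ℂ) • (exp (I • A) + exp (I • (-A))) := by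
  have hn := hA.isStarNormal
  have h2 : cfc (fun z : ℂ => Complex.exp (I * -z)) A = exp (I • (-A)) := by
    rw [← cfc_exp_I_mul hA.neg, ← cfc_comp_neg (fun z : ℂ => Complex.exp (I * z)) A]
  rw [← h2, ← cfc_exp_I_mul hA, ← cfc_add _ _ _, ← cfc_smul _ _ _]
  refine cfc_congr fun z hz => ?_
  have := hA.mem_spectrum_eq_re hz
  simp only [Complex.ofReal_cos, ← this, Complex.cos, smul_eq_mul]
  rw [mul_comm I z, mul_neg, mul_comm I z, neg_mul, div_eq_inv_mul]

theorem opModulus_cos_le {F : Set ℝ} {δ : ℝ} (hδ : δ ≤ Real.pi) :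
    opModulus.{u} (fun x => (Real.cos x : ℂ)) F δ ≤ ENNReal.ofReal (2 * Real.sin (δ / 2)) := by
  refine sSup_le ?_
  rintro _ ⟨H, _, _, _, A, B, hA, hB, -, -, h, rfl⟩
  rw [← ofReal_norm]
  refine ENNReal.ofReal_le_ofReal ?_
  rw [opFun_cos hA, opFun_cos hB, ← smul_sub, norm_smul, add_sub_add_comm]
  have h1 := norm_exp_I_smul_sub_exp_I_smul_le_two_mul_sin hA hB hδ h
  have h2 := norm_exp_I_smul_sub_exp_I_smul_le_two_mul_sin hA.neg hB.neg hδ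
    (by rwa [neg_sub_neg, norm_sub_rev])
  have h3 := norm_add_le (exp (I • A) - exp (I • B)) (exp (I • (-A)) - exp (I • (-B)))
  rw [show ‖(2⁻¹ : ℂ)‖ = 2⁻¹ by simp]
  linarith

end CosUpper

/-! ### Norm bounds for finite matrices. -/

section MatrixBounds

variable {ι : Type*} [Fintype ι] [DecidableEq ι]

theorem norm_toEuclideanCLM_le_of_bilinear {M : Matrix ι ι ℂ} {C : ℝ} (hC : 0 ≤ C)
    (h : ∀ u v : ι → ℂ, ‖∑ i, ∑ j, M i j * (u j * v i)‖ ≤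
      C / 2 * (∑ i, ‖u i‖ ^ 2 + ∑ i, ‖v i‖ ^ 2)) :
    ‖Matrix.toEuclideanCLM (𝕜 := ℂ) M‖ ≤ C := by
  refine ContinuousLinearMap.opNorm_le_of_re_inner_le hC fun x y hx hy => ?_
  refine (RCLike.re_le_norm _).trans ?_
  rw [norm_inner_symm]
  -- Conjugating `y` converts the sesquilinear form into the bilinear form of the hypothesis.
  have h1 := h x.ofLp (fun i => star (y.ofLp i))
  have hx' : ∑ i, ‖x.ofLp i‖ ^ 2 = 1 := by rw [← EuclideanSpace.norm_sq_eq, hx, one_pow]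
  have hy' : ∑ i, ‖star (y.ofLp i)‖ ^ 2 = 1 := by
    simp_rw [norm_star]; rw [← EuclideanSpace.norm_sq_eq, hy, one_pow]
  rw [hx', hy'] at h1
  have h2 : inner ℂ y (Matrix.toEuclideanCLM (𝕜 := ℂ) M x) =
      ∑ i, ∑ j, M i j * (x.ofLp j * star (y.ofLp i)) := by
    rw [PiLp.inner_apply]
    refine Finset.sum_congr rfl fun i _ => ?_
    rw [Matrix.ofLp_toEuclideanCLM, RCLike.inner_apply, Matrix.mulVec, dotProduct,
      Finset.sum_mul]
    exact Finset.sum_congr rfl fun j _ => by rw [mul_assoc]; rfl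
  rw [h2]
  linarith

/-- Schur's test, from `|u_j v_i| ≤ (|u_j|² + |v_i|²) / 2`. -/
theorem norm_toEuclideanCLM_le_of_row_sum_le {M : Matrix ι ι ℂ} {C : ℝ} (hC : 0 ≤ C)
    (hrow : ∀ i, ∑ j, ‖M i j‖ ≤ C) (hcol : ∀ j, ∑ i, ‖M i j‖ ≤ C) :
    ‖Matrix.toEuclideanCLM (𝕜 := ℂ) M‖ ≤ C := by
  refine norm_toEuclideanCLM_le_of_bilinear hC fun u v => ?_
  calc ‖∑ i, ∑ j, M i j * (u j * v i)‖
      ≤ ∑ i, ∑ j, ‖M i j * (u j * v i)‖ :=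
        (norm_sum_le _ _).trans (Finset.sum_le_sum fun i _ => norm_sum_le _ _)
    _ ≤ ∑ i, ∑ j, (‖M i j‖ * ‖u j‖ ^ 2 / 2 + ‖M i j‖ * ‖v i‖ ^ 2 / 2) := by
        refine Finset.sum_le_sum fun i _ => Finset.sum_le_sum fun j _ => ?_
        rw [norm_mul, norm_mul]
        nlinarith [norm_nonneg (M i j), mul_nonneg (norm_nonneg (M i j))
          (sq_nonneg (‖u j‖ - ‖v i‖))]
    _ = ∑ j, (∑ i, ‖M i j‖) * (‖u j‖ ^ 2 / 2) + ∑ i, (∑ j, ‖M i j‖) * (‖v i‖ ^ 2 / 2) := by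
        simp_rw [Finset.sum_add_distrib, Finset.sum_mul]
        rw [Finset.sum_comm]
        simp_rw [mul_div_assoc]
    _ ≤ ∑ j, C * (‖u j‖ ^ 2 / 2) + ∑ i, C * (‖v i‖ ^ 2 / 2) := by
        gcongr with j _ i _
        · exact hcol j
        · exact hrow i
    _ = C / 2 * (∑ i, ‖u i‖ ^ 2 + ∑ i, ‖v i‖ ^ 2) := by
        rw [mul_add, Finset.mul_sum, Finset.mul_sum]
        congr 1 <;> exact Finset.sum_congr rfl fun i _ => by ring

end MatrixBounds

/-! ### Fourier coefficients of the triangle wave. -/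

section TriangleWave

open Real

/-- The Fourier coefficients of the triangle wave of height `1`. -/
noncomputable def triangleCoeff (n : ℤ) : ℝ := if Odd n then 4 / (π ^ 2 * n ^ 2) else 0

theorem triangleCoeff_nonneg (n : ℤ) : 0 ≤ triangleCoeff n := by
  unfold triangleCoeff; split_ifs <;> positivity

theorem triangleCoeff_neg (n : ℤ) : triangleCoeff (-n) = triangleCoeff n := by
  simp [triangleCoeff]

theorem hasSum_triangleCoeff_nat : HasSum (fun n : ℕ => triangleCoeff n) 2⁻¹ := by
  have hz := hasSum_zeta_two
  have he : HasSum (fun k : ℕ => (1 : ℝ) / ((2 * k : ℕ) : ℝ) ^ 2) (π ^ 2 / 24) := by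
    convert! hz.mul_left 4⁻¹ using 1
    · funext k; push_cast; rw [mul_pow]; ring
    · ring
  have hs : Summable fun k : ℕ => (1 : ℝ) / ((2 * k + 1 : ℕ) : ℝ) ^ 2 :=
    hz.summable.comp_injective (i := fun k : ℕ => 2 * k + 1) fun a b h => by
      simp only at h; omega
  have ho : HasSum (fun k : ℕ => (1 : ℝ) / ((2 * k + 1 : ℕ) : ℝ) ^ 2) (π ^ 2 / 8) := by
    have h1 := he.even_add_odd (f := fun n : ℕ => (1 : ℝ) / (n : ℝ) ^ 2) hs.hasSum
    have h2 := h1.unique hz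
    convert! hs.hasSum using 1
    linarith
  have h0 : HasSum (fun k : ℕ => triangleCoeff ((2 * k : ℕ) : ℤ)) 0 := by
    have h : (fun k : ℕ => triangleCoeff ((2 * k : ℕ) : ℤ)) = fun _ => 0 := by
      funext k
      have : ¬ Odd (((2 * k : ℕ) : ℤ)) := by simp
      rw [triangleCoeff, if_neg this]
    rw [h]
    exact hasSum_zero
  have h1 : HasSum (fun k : ℕ => triangleCoeff ((2 * k + 1 : ℕ) : ℤ)) 2⁻¹ := by
    convert! ho.mul_left (4 / π ^ 2) using 1
    · funext k
      have : Odd (((2 * k + 1 : ℕ) : ℤ)) := ⟨k, by push_cast; ring⟩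
      rw [triangleCoeff, if_pos this]
      push_cast
      field_simp
    · have := pi_pos
      field_simp
      norm_num
  have h := h0.even_add_odd (f := fun n : ℕ => triangleCoeff n) h1
  rwa [zero_add] at h

theorem triangleCoeff_zero : triangleCoeff 0 = 0 := by simp [triangleCoeff]

theorem hasSum_triangleCoeff : HasSum triangleCoeff 1 := by
  have h := hasSum_triangleCoeff_nat
  have h' : HasSum (fun n : ℕ => triangleCoeff (-n)) 2⁻¹ := by simpa [triangleCoeff_neg] using h
  have := h.of_nat_of_neg h'
  rw [triangleCoeff_zero] at this
  convert! this using 1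
  norm_num

theorem sum_triangleCoeff_le {ι : Type*} [Fintype ι] {k : ι → ℤ} (hk : Function.Injective k) :
    ∑ i, triangleCoeff (k i) ≤ 1 := by
  rw [← hasSum_triangleCoeff.tsum_eq]
  calc ∑ i, triangleCoeff (k i) = ∑ n ∈ Finset.univ.map ⟨k, hk⟩, triangleCoeff n := by simp
    _ ≤ _ := hasSum_triangleCoeff.summable.sum_le_tsum _ fun n _ => triangleCoeff_nonneg n

/-- Enlarging the section by one row and one column adds two equal partial sums, since the
coefficients are even and vanish at `0`. The average in `tendsto_sum_sum_triangleCoeff_div` is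
thereby a Cesàro mean. -/
theorem sum_sum_triangleCoeff (N : ℕ) :
    ∑ i ∈ Finset.range N, ∑ j ∈ Finset.range N, triangleCoeff (i - j) =
      ∑ m ∈ Finset.range N, 2 * ∑ n ∈ Finset.range (m + 1), triangleCoeff n := by
  induction N with
  | zero => simp
  | succ N ih =>
    have h1 : ∑ n ∈ Finset.range (N + 1), triangleCoeff n =
        ∑ j ∈ Finset.range N, triangleCoeff (N - j) := by
      rw [Finset.sum_range_succ', ← Finset.sum_range_reflect]
      simp only [Nat.cast_zero, triangleCoeff_zero, add_zero]
      refine Finset.sum_congr rfl fun j hj => ?_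
      have := Finset.mem_range.mp hj
      congr 1
      omega
    have h2 : ∑ i ∈ Finset.range N, triangleCoeff (i - N) =
        ∑ j ∈ Finset.range N, triangleCoeff (N - j) :=
      Finset.sum_congr rfl fun j _ => by rw [← triangleCoeff_neg, neg_sub]
    calc ∑ i ∈ Finset.range (N + 1), ∑ j ∈ Finset.range (N + 1), triangleCoeff (i - j)
        = ∑ i ∈ Finset.range N, (∑ j ∈ Finset.range N, triangleCoeff (i - j) +
            triangleCoeff (i - N)) +
          (∑ j ∈ Finset.range N, triangleCoeff (N - j) + triangleCoeff (N - N)) := by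
          simp_rw [← Finset.sum_range_succ (fun j : ℕ => triangleCoeff (_ - (j : ℤ))) N]
          exact Finset.sum_range_succ _ N
      _ = ∑ m ∈ Finset.range N, 2 * ∑ n ∈ Finset.range (m + 1), triangleCoeff n +
          2 * ∑ n ∈ Finset.range (N + 1), triangleCoeff n := by
          rw [Finset.sum_add_distrib, ih, h2, h1, sub_self, triangleCoeff_zero]
          ring
      _ = _ := (Finset.sum_range_succ
          (fun m => 2 * ∑ n ∈ Finset.range (m + 1), triangleCoeff n) N).symm

theorem tendsto_sum_sum_triangleCoeff_div :
    Filter.Tendsto (fun N : ℕ => (N : ℝ)⁻¹ *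
      ∑ i ∈ Finset.range N, ∑ j ∈ Finset.range N, triangleCoeff (i - j))
      Filter.atTop (nhds 1) := by
  simp_rw [sum_sum_triangleCoeff]
  refine Filter.Tendsto.cesaro ?_
  have h := (hasSum_triangleCoeff_nat.tendsto_sum_nat.comp
    (Filter.tendsto_add_atTop_nat 1)).const_mul 2
  simpa using h

end TriangleWave

/-! ### The bilinear form of the square wave. -/

section SquareWave

open Complex intervalIntegral
open scoped Real

theorem integral_exp_I_int_Icc_zero_pi {n : ℤ} (hn : n ≠ 0) :
    ∫ θ in (0 : ℝ)..π, exp (n * I * θ) = ((-1) ^ n - 1) / (n * I) := by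
  have hc : (n * I : ℂ) ≠ 0 := mul_ne_zero (by exact_mod_cast hn) I_ne_zero
  rw [integral_exp_mul_complex hc]
  have : exp (n * I * π) = (-1) ^ n := by
    rw [← exp_pi_mul_I, ← exp_int_mul]; ring_nf
  rw [this]; simp

theorem integral_exp_I_int_Icc_neg_pi_zero {n : ℤ} (hn : n ≠ 0) :
    ∫ θ in (-π)..(0 : ℝ), exp (n * I * θ) = (1 - (-1) ^ n) / (n * I) := by
  have hc : (n * I : ℂ) ≠ 0 := mul_ne_zero (by exact_mod_cast hn) I_ne_zero
  rw [integral_exp_mul_complex hc]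
  have : exp (n * I * ((-π : ℝ) : ℂ)) = (-1) ^ n := by
    rw [← Int.cast_negOnePow, ← Int.negOnePow_neg, Int.cast_negOnePow, ← exp_pi_mul_I,
      ← exp_int_mul]
    push_cast
    ring_nf
  rw [this]; simp

/-- Multiplying the triangle-wave coefficients by `n` differentiates the wave, which gives a square
wave. -/
theorem integral_exp_I_int_sub (n : ℤ) :
    (∫ θ in (0 : ℝ)..π, exp (n * I * θ)) - ∫ θ in (-π)..(0 : ℝ), exp (n * I * θ) =
      π * I * (π * n * triangleCoeff n) := by
  rcases eq_or_ne n 0 with rfl | hn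
  · simp
  have hpi : (π : ℂ) ≠ 0 := by exact_mod_cast Real.pi_ne_zero
  have hn' : (n : ℂ) ≠ 0 := by exact_mod_cast hn
  rw [integral_exp_I_int_Icc_zero_pi hn, integral_exp_I_int_Icc_neg_pi_zero hn, triangleCoeff]
  split_ifs with h
  · rw [h.neg_one_zpow]
    push_cast
    field_simp
    rw [I_sq]
    ring
  · rw [(Int.not_odd_iff_even.mp h).neg_one_zpow]
    simp

theorem integral_exp_I_int_add (n : ℤ) :
    ∫ θ in (-π)..π, exp (n * I * θ) = if n = 0 then (2 * π : ℂ) else 0 := by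
  split_ifs with hn
  · subst hn; simp; ring
  have hint : ∀ a b : ℝ,
      IntervalIntegrable (fun θ : ℝ => exp (n * I * θ)) MeasureTheory.volume a b := fun a b =>
     Continuous.intervalIntegrable (by fun_prop) a b
  rw [← integral_add_adjacent_intervals (hint _ 0) (hint 0 _), integral_exp_I_int_Icc_zero_pi hn,
    integral_exp_I_int_Icc_neg_pi_zero hn]
  ring

variable {ι : Type*} [Fintype ι] [DecidableEq ι]

theorem integral_norm_sq_sum_mul_exp {k : ι → ℤ} (hk : Function.Injective k) (u : ι → ℂ) :
    ∫ θ in (-π)..π, ‖∑ j, u j * exp (k j * I * θ)‖ ^ 2 = 2 * π * ∑ j, ‖u j‖ ^ 2 := by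
  apply ofReal_injective
  rw [← integral_ofReal]
  have h1 : ∀ θ : ℝ, ((‖∑ j, u j * exp (k j * I * θ)‖ ^ 2 : ℝ) : ℂ) =
      ∑ j, ∑ l, u j * star (u l) * exp ((k j - k l : ℤ) * I * θ) := by
    intro θ
    rw [ofReal_pow, ← mul_conj', map_sum, Finset.sum_mul_sum]
    refine Finset.sum_congr rfl fun j _ => Finset.sum_congr rfl fun l _ => ?_
    rw [map_mul, ← exp_conj, mul_mul_mul_comm, ← exp_add]
    simp only [map_mul, conj_I, conj_ofReal, map_intCast]
    congr 2
    push_cast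
    ring
  simp_rw [h1]
  rw [integral_finsetSum fun j _ => Continuous.intervalIntegrable (by fun_prop) _ _]
  have h2 : ∀ j, ∫ θ in (-π)..π, ∑ l, u j * star (u l) * exp ((k j - k l : ℤ) * I * θ) =
      2 * π * (‖u j‖ ^ 2 : ℝ) := by
    intro j
    rw [integral_finsetSum fun l _ => Continuous.intervalIntegrable (by fun_prop) _ _]
    simp_rw [integral_const_mul, integral_exp_I_int_add, sub_eq_zero, hk.eq_iff]
    rw [Finset.sum_eq_single j]
    · rw [if_pos rfl, ofReal_pow, ← mul_conj', mul_comm]; rfl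
    · intro l _ hl; rw [if_neg (Ne.symm hl), mul_zero]
    · simp
  simp_rw [h2]
  push_cast
  rw [Finset.mul_sum]

/-- Up to the factor `πi`, the form is the integral of `sign(θ) U(θ) V(θ)` over a period, with `U`,
`V` trigonometric polynomials. Bound `|U V|` by `(|U|² + |V|²) / 2` and apply Parseval. -/
theorem norm_sum_sum_squareWave_le {k : ι → ℤ} (hk : Function.Injective k) (u v : ι → ℂ) :
    ‖∑ i, ∑ j, ((π * (k i - k j : ℤ) * triangleCoeff (k i - k j) : ℝ) : ℂ) * (u j * v i)‖ ≤
      ∑ i, ‖u i‖ ^ 2 + ∑ i, ‖v i‖ ^ 2 := by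
  set U : ℝ → ℂ := fun θ => ∑ j, u j * exp ((-k j : ℤ) * I * θ) with hU
  set V : ℝ → ℂ := fun θ => ∑ i, v i * exp (k i * I * θ) with hV
  have hUc : Continuous U := by fun_prop
  have hVc : Continuous V := by fun_prop
  have hUV : ∀ a b : ℝ, ∫ θ in a..b, U θ * V θ =
      ∑ i, ∑ j, (∫ θ in a..b, exp ((k i - k j : ℤ) * I * θ)) * (u j * v i) := by
    intro a b
    have h1 : ∀ θ, U θ * V θ =
        ∑ i, ∑ j, exp ((k i - k j : ℤ) * I * θ) * (u j * v i) := by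
      intro θ
      rw [hU, hV, mul_comm, Finset.sum_mul_sum]
      refine Finset.sum_congr rfl fun i _ => Finset.sum_congr rfl fun j _ => ?_
      rw [mul_mul_mul_comm, ← exp_add, mul_comm (v i), mul_comm]
      congr 2
      push_cast
      ring
    simp_rw [h1]
    rw [integral_finsetSum fun j _ => Continuous.intervalIntegrable (by fun_prop) _ _]
    refine Finset.sum_congr rfl fun i _ => ?_
    rw [integral_finsetSum fun j _ => Continuous.intervalIntegrable (by fun_prop) _ _]
    exact Finset.sum_congr rfl fun j _ => integral_mul_const _ _
  have hmain : (∫ θ in (0 : ℝ)..π, U θ * V θ) - ∫ θ in (-π)..(0 : ℝ), U θ * V θ =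
      π * I * ∑ i, ∑ j,
        ((π * (k i - k j : ℤ) * triangleCoeff (k i - k j) : ℝ) : ℂ) * (u j * v i) := by
    rw [hUV, hUV, ← Finset.sum_sub_distrib, Finset.mul_sum]
    refine Finset.sum_congr rfl fun i _ => ?_
    rw [← Finset.sum_sub_distrib, Finset.mul_sum]
    refine Finset.sum_congr rfl fun j _ => ?_
    rw [← sub_mul, integral_exp_I_int_sub]
    push_cast
    ring
  have hn : ∀ a b : ℝ, a ≤ b → ‖∫ θ in a..b, U θ * V θ‖ ≤
      ∫ θ in a..b, (‖U θ‖ ^ 2 + ‖V θ‖ ^ 2) / 2 := by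
    intro a b hab
    refine norm_integral_le_of_norm_le hab (Filter.Eventually.of_forall fun θ _ => ?_)
      (Continuous.intervalIntegrable (by fun_prop) _ _)
    rw [norm_mul]
    nlinarith [sq_nonneg (‖U θ‖ - ‖V θ‖)]
  have hpi := Real.pi_pos
  have hint : ∀ a b : ℝ, IntervalIntegrable (fun θ => (‖U θ‖ ^ 2 + ‖V θ‖ ^ 2) / 2)
      MeasureTheory.volume a b := fun a b => Continuous.intervalIntegrable (by fun_prop) _ _
  have htot : ∫ θ in (-π)..π, (‖U θ‖ ^ 2 + ‖V θ‖ ^ 2) / 2 =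
      π * (∑ i, ‖u i‖ ^ 2 + ∑ i, ‖v i‖ ^ 2) := by
    rw [intervalIntegral.integral_div,
      integral_add (Continuous.intervalIntegrable (by fun_prop) _ _)
      (Continuous.intervalIntegrable (by fun_prop) _ _),
      integral_norm_sq_sum_mul_exp (k := fun j => -k j) (fun a b h => hk (neg_injective h)) u,
      integral_norm_sq_sum_mul_exp hk v]
    ring
  have h := norm_sub_le (∫ θ in (0 : ℝ)..π, U θ * V θ) (∫ θ in (-π)..(0 : ℝ), U θ * V θ)
  rw [hmain, norm_mul, norm_mul, norm_I, mul_one, norm_real, Real.norm_of_nonneg hpi.le] at h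
  have h1 := hn 0 π hpi.le
  have h2 := hn (-π) 0 (by linarith)
  rw [← integral_add_adjacent_intervals (hint _ 0) (hint 0 _)] at htot
  refine le_of_mul_le_mul_left ?_ hpi
  linarith

end SquareWave

/-! ### Functional calculus of diagonal operators. -/

section DiagonalOperators

theorem isSelfAdjoint_ofReal_comp {ι : Type*} (d : ι → ℝ) : IsSelfAdjoint (fun i => (d i : ℂ)) :=
  funext fun i => Complex.conj_ofReal (d i)

theorem cfc_re_pi {ι : Type*} [Fintype ι] {f : ℝ → ℂ} (hf : Continuous f) (d : ι → ℝ) :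
    cfc (fun z : ℂ => f z.re) (fun i => (d i : ℂ)) = fun i => f (d i) := by
  funext i
  have h := (Pi.evalStarAlgHom ℂ (fun _ : ι => ℂ) i).map_cfc_re (isSelfAdjoint_ofReal_comp d)
    (hf.continuousOn (s := Set.univ)) fun z _ => Set.mem_univ _
  refine h.trans ?_
  exact cfc_algebraMap (A := ℂ) (d i : ℂ) (fun z : ℂ => f z.re)

variable {ι : Type*} [Fintype ι] [DecidableEq ι]

/-- Diagonal operators, as a star algebra homomorphism. -/
noncomputable def diagonalOp (ι : Type*) [Fintype ι] [DecidableEq ι] :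
    (ι → ℂ) →⋆ₐ[ℂ] (EuclideanSpace ℂ ι →L[ℂ] EuclideanSpace ℂ ι) :=
  (Matrix.toEuclideanCLM (𝕜 := ℂ) (n := ι)).toStarAlgHom.comp
    { Matrix.diagonalAlgHom ℂ with
      map_star' := fun d => (Matrix.diagonal_conjTranspose d).symm }

theorem diagonalOp_apply (d : ι → ℂ) :
    diagonalOp ι d = Matrix.toEuclideanCLM (𝕜 := ℂ) (Matrix.diagonal d) := rfl

theorem isSelfAdjoint_diagonalOp (d : ι → ℝ) : IsSelfAdjoint (diagonalOp ι fun i => (d i : ℂ)) :=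
  (isSelfAdjoint_ofReal_comp d).map (diagonalOp ι)

theorem opFun_diagonalOp {f : ℝ → ℂ} (hf : Continuous f) (d : ι → ℝ) :
    opFun f (diagonalOp ι fun i => (d i : ℂ)) = diagonalOp ι fun i => f (d i) := by
  rw [← cfc_re_pi hf]
  exact ((diagonalOp ι).map_cfc_re (isSelfAdjoint_ofReal_comp d)
    (hf.continuousOn (s := Set.univ)) fun z _ => Set.mem_univ _).symm

end DiagonalOperators

/-! ### Lower bound for the commutator modulus of the cosine. -/

section CosLower

open scoped Real

/-- The section of the Toeplitz matrix of the triangle wave with rows and columns given by `k`. -/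
noncomputable def triangleMatrix {ι : Type u} (k : ι → ℤ) : Matrix ι ι ℂ :=
  Matrix.of fun i j => (triangleCoeff (k i - k j) : ℂ)

theorem norm_triangleMatrix_apply {ι : Type u} (k : ι → ℤ) (i j : ι) :
    ‖triangleMatrix k i j‖ = triangleCoeff (k i - k j) := by
  rw [triangleMatrix, Matrix.of_apply, Complex.norm_real,
    Real.norm_of_nonneg (triangleCoeff_nonneg _)]

variable {ι : Type u} [Fintype ι] [DecidableEq ι]

theorem norm_triangleMatrix_le_one {k : ι → ℤ} (hk : Function.Injective k) :
    ‖Matrix.toEuclideanCLM (𝕜 := ℂ) (triangleMatrix k)‖ ≤ 1 := by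
  refine norm_toEuclideanCLM_le_of_row_sum_le zero_le_one (fun i => ?_) fun j => ?_
  · simp_rw [norm_triangleMatrix_apply]
    exact sum_triangleCoeff_le fun a b h => hk (sub_right_injective h)
  · simp_rw [norm_triangleMatrix_apply]
    exact sum_triangleCoeff_le fun a b h => hk (sub_left_injective h)

/-- Test the quadratic form on the all-ones vector. -/
theorem sum_triangleCoeff_le_card_mul_norm (k : ι → ℤ) :
    ∑ i, ∑ j, triangleCoeff (k i - k j) ≤
      Fintype.card ι * ‖Matrix.toEuclideanCLM (𝕜 := ℂ) (triangleMatrix k)‖ := by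
  set w : EuclideanSpace ℂ ι := WithLp.toLp 2 fun _ => 1 with hw
  have hwn : ‖w‖ ^ 2 = Fintype.card ι := by simp [EuclideanSpace.norm_sq_eq, hw]
  set T := Matrix.toEuclideanCLM (𝕜 := ℂ) (triangleMatrix k) with hT
  have h1 : inner ℂ w (T w) = ((∑ i, ∑ j, triangleCoeff (k i - k j) : ℝ) : ℂ) := by
    rw [PiLp.inner_apply]
    simp [hT, hw, Matrix.mulVec, dotProduct, triangleMatrix]
  calc ∑ i, ∑ j, triangleCoeff (k i - k j)
      ≤ ‖inner ℂ w (T w)‖ := by rw [h1, Complex.norm_real]; exact Real.le_norm_self _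
    _ ≤ ‖w‖ * ‖T w‖ := norm_inner_le_norm _ _
    _ ≤ ‖w‖ * (‖T‖ * ‖w‖) := by gcongr; exact T.le_opNorm w
    _ = _ := by rw [← hwn]; ring

theorem norm_diagonal_commutator_triangleMatrix_le {k : ι → ℤ} (hk : Function.Injective k) :
    ‖diagonalOp ι (fun i => ((π * k i : ℝ) : ℂ)) *
        Matrix.toEuclideanCLM (𝕜 := ℂ) (triangleMatrix k) -
      Matrix.toEuclideanCLM (𝕜 := ℂ) (triangleMatrix k) *
        diagonalOp ι (fun i => ((π * k i : ℝ) : ℂ))‖ ≤ 2 := by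
  rw [diagonalOp_apply, ← map_mul, ← map_mul, ← map_sub]
  refine norm_toEuclideanCLM_le_of_bilinear zero_le_two fun u v => ?_
  rw [div_self two_ne_zero, one_mul]
  refine le_trans (le_of_eq ?_) (norm_sum_sum_squareWave_le hk u v)
  congr 1
  refine Finset.sum_congr rfl fun i _ => Finset.sum_congr rfl fun j _ => ?_
  rw [Matrix.sub_apply, Matrix.diagonal_mul, Matrix.mul_diagonal, triangleMatrix, Matrix.of_apply]
  push_cast
  ring

theorem norm_cos_diagonal_commutator_triangleMatrix (k : ι → ℤ) :
    ‖opFun (fun x => (Real.cos x : ℂ)) (diagonalOp ι (fun i => ((π * k i : ℝ) : ℂ))) *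
        Matrix.toEuclideanCLM (𝕜 := ℂ) (triangleMatrix k) -
      Matrix.toEuclideanCLM (𝕜 := ℂ) (triangleMatrix k) *
        opFun (fun x => (Real.cos x : ℂ)) (diagonalOp ι (fun i => ((π * k i : ℝ) : ℂ)))‖ =
      2 * ‖Matrix.toEuclideanCLM (𝕜 := ℂ) (triangleMatrix k)‖ := by
  have hcos : ∀ i, (Real.cos (π * k i) : ℂ) = (-1) ^ k i := fun i => by
    rw [mul_comm, Real.cos_int_mul_pi]
    push_cast
    rfl
  rw [opFun_diagonalOp (f := fun x => (Real.cos x : ℂ)) (by fun_prop)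
    (fun i => π * k i)]
  simp_rw [hcos]
  set s : ι → ℂ := fun i => (-1) ^ k i with hs
  have hsq : ∀ i, s i * s i = 1 := fun i => by
    rw [hs, ← mul_zpow]; simp
  have hsu : diagonalOp ι s ∈ unitary (EuclideanSpace ℂ ι →L[ℂ] EuclideanSpace ℂ ι) := by
    have hss : star s = s := funext fun i => by simp [hs]
    have h1 : s * s = 1 := funext hsq
    have h2 : diagonalOp ι s * diagonalOp ι s = 1 := by rw [← map_mul, h1, map_one]
    rw [Unitary.mem_iff, ← map_star, hss]
    exact ⟨h2, h2⟩
  -- A nonzero entry has `k i - k j` odd, so `(-1)^(k i)` and `(-1)^(k j)` are opposite.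
  have hanti : Matrix.toEuclideanCLM (𝕜 := ℂ) (triangleMatrix k) * diagonalOp ι s =
      -(diagonalOp ι s * Matrix.toEuclideanCLM (𝕜 := ℂ) (triangleMatrix k)) := by
    rw [diagonalOp_apply, ← map_mul, ← map_mul, ← map_neg]
    congr 1
    ext i j
    rw [Matrix.neg_apply, Matrix.diagonal_mul, Matrix.mul_diagonal, triangleMatrix,
      Matrix.of_apply, triangleCoeff]
    split_ifs with hodd
    · have : s i = -s j := by
        have h1 : s i = (-1) ^ (k i - k j) * (-1) ^ k j := by
          rw [← zpow_add₀ (by norm_num)]; simp [hs]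
        rw [h1, hodd.neg_one_zpow]; simp [hs]
      rw [this]; ring
    · simp
  rw [hanti, sub_neg_eq_add, ← two_smul ℂ, norm_smul, norm_mem_unitary_mul hsu]
  simp

theorem two_mul_average_le_commModulus_cos (N : ℕ) :
    ENNReal.ofReal (2 * ((N : ℝ)⁻¹ *
      ∑ i ∈ Finset.range N, ∑ j ∈ Finset.range N, triangleCoeff (i - j))) ≤
      commModulus.{u} (fun x => (Real.cos x : ℂ)) Set.univ 2 := by
  -- The indices `0, …, N - 1`, lifted so that the Hilbert space lies in universe `u`.
  let k : ULift.{u} (Fin N) → ℤ := fun i => (i.down : ℕ)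
  have hk : Function.Injective k := fun a b h =>
    ULift.ext _ _ (Fin.ext (by simpa [k] using h))
  have h := enorm_opFun_mul_sub_le_commModulus (f := fun x => (Real.cos x : ℂ)) (F := Set.univ)
    (isSelfAdjoint_diagonalOp fun i => π * k i) (isSelfAdjoint_diagonalOp fun i => π * k i)
    (fun z _ => Set.mem_univ _) (fun z _ => Set.mem_univ _) (norm_triangleMatrix_le_one hk)
    (norm_diagonal_commutator_triangleMatrix_le hk)
  refine le_trans ?_ h
  rw [← ofReal_norm, norm_cos_diagonal_commutator_triangleMatrix]
  refine ENNReal.ofReal_le_ofReal (mul_le_mul_of_nonneg_left ?_ zero_le_two)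
  rcases Nat.eq_zero_or_pos N with rfl | hN
  · simp
  rw [inv_mul_le_iff₀ (by exact_mod_cast hN)]
  have h1 := sum_triangleCoeff_le_card_mul_norm k
  have h2 : ∑ i, ∑ j, triangleCoeff (k i - k j) =
      ∑ i ∈ Finset.range N, ∑ j ∈ Finset.range N, triangleCoeff (i - j) := by
    simp_rw [Finset.sum_range]
    exact Fintype.sum_equiv Equiv.ulift _ _ fun i => Fintype.sum_equiv Equiv.ulift _ _ fun j => rfl
  rw [h2] at h1
  simpa using h1

theorem two_le_commModulus_cos :
    2 ≤ commModulus.{u} (fun x => (Real.cos x : ℂ)) Set.univ 2 := by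
  have h := ENNReal.tendsto_ofReal (tendsto_sum_sum_triangleCoeff_div.const_mul 2)
  have h2 := le_of_tendsto' h two_mul_average_le_commModulus_cos.{u}
  simpa using h2

end CosLower

/-! ### Sharpness of `csc 1`, its numerical value, and the main theorem. -/

theorem commModulus_cos_eq :
    0 < opModulus.{u} (fun x => (Real.cos x : ℂ)) Set.univ 2 ∧
    opModulus.{u} (fun x => (Real.cos x : ℂ)) Set.univ 2 < ∞ ∧
    commModulus.{u} (fun x => (Real.cos x : ℂ)) Set.univ 2 =
      ENNReal.ofReal (1 / Real.sin 1) * opModulus.{u} (fun x => (Real.cos x : ℂ)) Set.univ 2 := by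
  have hcont : Continuous fun x : ℝ => (Real.cos x : ℂ) := by fun_prop
  have hsin : 0 < Real.sin 1 :=
    Real.sin_pos_of_pos_of_lt_pi one_pos (by linarith [Real.pi_gt_three])
  have hup : opModulus.{u} (fun x => (Real.cos x : ℂ)) Set.univ 2 ≤
      ENNReal.ofReal (2 * Real.sin 1) := by
    simpa using opModulus_cos_le.{u} (F := Set.univ) (δ := 2) (by linarith [Real.pi_gt_three])
  have hle := commModulus_le.{u} (hcont.continuousOn (s := Set.univ)) 2
  have hlow := two_le_commModulus_cos.{u}
  refine ⟨?_, hup.trans_lt ENNReal.ofReal_lt_top, le_antisymm hle ?_⟩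
  -- If `Ω(2)` vanished, so would `Ω♭(2)`, which is at least `2`.
  · rw [pos_iff_ne_zero]
    intro h0
    rw [h0, mul_zero] at hle
    exact absurd (hlow.trans hle) (by simp)
  · calc ENNReal.ofReal (1 / Real.sin 1) * opModulus.{u} (fun x => (Real.cos x : ℂ)) Set.univ 2
        ≤ ENNReal.ofReal (1 / Real.sin 1) * ENNReal.ofReal (2 * Real.sin 1) := by gcongr
      _ = 2 := by
        rw [← ENNReal.ofReal_mul (by positivity)]
        have : 1 / Real.sin 1 * (2 * Real.sin 1) = 2 := by field_simp
        rw [this]; simp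
      _ ≤ _ := hlow

theorem one_div_sin_one_lt : 1 / Real.sin 1 < 1.1884 := by
  -- The imaginary part of the degree `9` Taylor polynomial of `exp` at `I` approximates `sin 1`
  -- closely enough to separate it from `1 / 1.1884`.
  have h := Complex.exp_bound (x := Complex.I) (by simp) (n := 10) (by norm_num)
  have him := (Complex.abs_im_le_norm _).trans h
  have hs : (Complex.exp Complex.I).im = Real.sin 1 := by
    have := Complex.exp_ofReal_mul_I_im 1
    simpa using this
  have hsum : (∑ m ∈ Finset.range 10, Complex.I ^ m / (m.factorial : ℂ)).im =
      1 - 1 / 6 + 1 / 120 - 1 / 5040 + 1 / 362880 := by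
    have e : ∑ m ∈ Finset.range 10, Complex.I ^ m / (m.factorial : ℂ) =
        ((1 - 1 / 2 + 1 / 24 - 1 / 720 + 1 / 40320 : ℝ) : ℂ) +
          ((1 - 1 / 6 + 1 / 120 - 1 / 5040 + 1 / 362880 : ℝ) : ℂ) * Complex.I := by
      have h3 : Complex.I ^ 3 = -Complex.I := by rw [pow_succ, Complex.I_sq]; ring
      have h4 := Complex.I_pow_four
      simp only [Finset.sum_range_succ, Finset.sum_range_zero, Nat.factorial]
      have h5 : Complex.I ^ 5 = Complex.I := by rw [pow_succ, h4, one_mul]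
      have h6 : Complex.I ^ 6 = -1 := by rw [pow_succ, h5, Complex.I_mul_I]
      have h7 : Complex.I ^ 7 = -Complex.I := by rw [pow_succ, h6]; ring
      have h8 : Complex.I ^ 8 = 1 := by rw [pow_succ, h7]; simp
      have h9 : Complex.I ^ 9 = Complex.I := by rw [pow_succ, h8, one_mul]
      rw [h3, h4, h5, h6, h7, h8, h9, Complex.I_sq]
      push_cast
      ring
    rw [e]
    simp
  rw [Complex.sub_im, hs, hsum] at him
  simp only [Complex.norm_I, one_pow, one_mul, Nat.factorial] at him
  have h1 := (abs_le.mp him).1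
  norm_num at h1
  have h2 : (1 : ℝ) / 1.1884 < Real.sin 1 := by norm_num; linarith
  rw [div_lt_comm₀ (by linarith [show (0 : ℝ) < 1 / 1.1884 by norm_num]) (by norm_num)]
  exact h2

theorem mainTheorem3 :
    -- the estimates, for every closed set `F` and every continuous `f : F → ℂ`
    (∀ (F : Set ℝ) (f : ℝ → ℂ), IsClosed F → ContinuousOn f F →
      (∀ (H : Type u) [NormedAddCommGroup H] [InnerProductSpace ℂ H] [CompleteSpace H]
        (A B X : H →L[ℂ] H), IsSelfAdjoint A → IsSelfAdjoint B →
        spectrum ℝ A ⊆ F → spectrum ℝ B ⊆ F → 0 < ‖X‖ → ‖X‖ < Real.pi →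
        ‖opFun f A * X - X * opFun f B‖ₑ ≤
          ENNReal.ofReal (‖X‖ / Real.sin ‖X‖) * opModulus.{u} f F ‖A * X - X * B‖) ∧
      (∀ δ : ℝ, 0 ≤ δ →
        opModulus.{u} f F δ ≤ commModulus.{u} f F δ ∧
        commModulus.{u} f F δ ≤ ENNReal.ofReal (1 / Real.sin 1) * opModulus.{u} f F δ)) ∧
    -- the first inequality is sharp, on every closed set with at least two points
    (∀ F : Set ℝ, IsClosed F → F.Nontrivial →
      ∃ f : ℝ → ℝ, ContinuousOn f F ∧ ∀ δ : ℝ, 0 < δ →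
        0 < opModulus.{u} (fun x => (f x : ℂ)) F δ ∧
        opModulus.{u} (fun x => (f x : ℂ)) F δ < ∞ ∧
        opModulus.{u} (fun x => (f x : ℂ)) F δ = commModulus.{u} (fun x => (f x : ℂ)) F δ) ∧
    -- the second inequality is sharp for `F = ℝ`: equality occurs with finite nonzero values
    (∃ f : ℝ → ℝ, Continuous f ∧ ∃ δ : ℝ, 0 < δ ∧
      0 < opModulus.{u} (fun x => (f x : ℂ)) Set.univ δ ∧
      opModulus.{u} (fun x => (f x : ℂ)) Set.univ δ < ∞ ∧
      commModulus.{u} (fun x => (f x : ℂ)) Set.univ δ =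
        ENNReal.ofReal (1 / Real.sin 1) * opModulus.{u} (fun x => (f x : ℂ)) Set.univ δ) ∧
    1 / Real.sin 1 < 1.1884 := by
  refine ⟨fun F f _ hf => ⟨fun H _ _ _ A B X hA hB hAF hBF h0 hpi =>
      enorm_opFun_mul_sub_le hf hA hB (hA.spectrum_real_subset_iff.mp hAF)
        (hB.spectrum_real_subset_iff.mp hBF) h0 hpi le_rfl le_rfl,
    fun δ _ => ⟨opModulus_le_commModulus f F δ, commModulus_le hf δ⟩⟩, fun F _ hF =>
    ⟨id, continuousOn_id, fun δ hδ => ⟨opModulus_id_pos hF hδ, opModulus_id_lt_top F δ,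
      le_antisymm (opModulus_le_commModulus _ F δ) (commModulus_id_le_opModulus_id F δ)⟩⟩,
    ⟨Real.cos, Real.continuous_cos, 2, two_pos, commModulus_cos_eq⟩, one_div_sin_one_lt⟩
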